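/- Theorem (Higher dimensional case). Let $n$ and $k$ be positive integers and let $\Omega\subseteq\mathbb{R}^n$ be an open set. For $\alpha\in(0,1]$ let $C^{k,\alpha}(\Omega)$ be the set of all $g\in C^k(\Omega)$ whose partial derivatives of orders $1,\dots,k$ are bounded in $\Omega$ and whose partial derivatives of order $k$ are $\alpha$-Hölder continuous in $\Omega$; for such $g$ let $\mathrm{H\ddot{o}ld}_\alpha(g^{(k)},\Omega)$ be the maximum, over all partial derivatives $h$ of $g$ of order $k$, of the Hölder constants $\sup\{|h(y)-h(x)|/|y-x|^{\alpha} : x,y\in\Omega,\ x\neq y\}$. For $p\ge 1$, a bounded open set $\Omega'\subseteq\mathbb{R}^n$ and a measurable $\psi:\Omega'\to\mathbb{R}^n$ let $$\|\psi\|_{p,w,\Omega'}:=\sup_{M\ge 0} M\cdot\big[\mathrm{meas}\{x\in\Omega' : |\psi(x)|>M\}\big]^{1/p},$$ where $\mathrm{meas}$ is the Lebesgue measure, and let $L^p_w(\Omega')$ be the set of those $\psi$ for which this is finite. Then for every open set $\Omega'$ whose closure is compact and contained in $\Omega$ (in symbols $\Omega'\subset\subset\Omega$) there are constants $C_1$ and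 $C_2$, which depend only on $n$, $k$, $\Omega$ and $\Omega'$, such that the following holds. Let $\alpha\in(0,1]$, let $p$ be defined by $\frac1p+\frac1{k+\alpha}=1$, let $f:\Omega\to\mathbb{R}$ be continuous, and let $g\in C^{k,\alpha}(\Omega)$ satisfy $|f(x)|^{k+\alpha}=|g(x)|$ for every $x\in\Omega$. Then the distributional gradient $\nabla f$ of $f$ in $\Omega$ is a locally integrable function in $\Omega$ (which does not depend on $\Omega'$), it belongs to $L^p_w(\Omega')$, and $$\|\nabla f\|_{p,w,\Omega'}\le\max\Big\{C_1\,\big[\mathrm{H\ddot{o}ld}_\alpha(g^{(k)},\Omega)\big]^{1/(k+\alpha)},\ C_2\,\|\nabla g\|_{L^\infty(\Omega)}^{1/(k+\alpha)}\Big\}.$$ -/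

import Mathlib

open scoped ENNReal NNReal ContDiff Gradient
open MeasureTheory

namespace RootRegularity

noncomputable section

/-- The partial derivative `∂_{s 0} ∂_{s 1} ⋯ ∂_{s (j-1)} g` of order `j`. It is read only at points
near which `g` is of class `C^j`. -/
def partialDeriv {n j : ℕ} (s : Fin j → Fin n) (g : EuclideanSpace ℝ (Fin n) → ℝ)
    (x : EuclideanSpace ℝ (Fin n)) : ℝ :=
  iteratedFDeriv ℝ j g x (fun i => EuclideanSpace.single (s i) (1 : ℝ))

/-- The class `C^{k,α}(Ω)`: functions of class `C^k` on `Ω` whose partial derivatives of the orders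
`1, …, k` are bounded in `Ω`, and whose partial derivatives of order `k` are `α`-Hölder continuous
in `Ω`. -/
structure MemCkHolder {n : ℕ} (k : ℕ) (α : ℝ≥0) (g : EuclideanSpace ℝ (Fin n) → ℝ)
    (Ω : Set (EuclideanSpace ℝ (Fin n))) : Prop where
  contDiffOn : ContDiffOn ℝ k g Ω
  bounded : ∀ j : ℕ, 1 ≤ j → j ≤ k → ∀ s : Fin j → Fin n,
    ∃ B : ℝ, ∀ x ∈ Ω, |partialDeriv s g x| ≤ B
  holder : ∀ s : Fin k → Fin n, ∃ H : ℝ≥0, HolderOnWith H α (partialDeriv s g) Ω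

/-- The maximum, over all partial derivatives of `g` of order `k`, of their `α`-Hölder constants
in `Ω` (the smallest admissible constants, `∞` if there is none). -/
def holderConst {n : ℕ} (k : ℕ) (α : ℝ≥0) (g : EuclideanSpace ℝ (Fin n) → ℝ)
    (Ω : Set (EuclideanSpace ℝ (Fin n))) : ℝ≥0∞ :=
  ⨆ s : Fin k → Fin n, eHolderNorm α (fun x : Ω => partialDeriv s g x)

/-- The weak `L^p` quasinorm `sup_{M ≥ 0} M · meas {x ∈ Ω : |ψ x| > M} ^ (1/p)`. -/
def weakLpNorm {n : ℕ} (p : ℝ)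
    (ψ : EuclideanSpace ℝ (Fin n) → EuclideanSpace ℝ (Fin n))
    (Ω : Set (EuclideanSpace ℝ (Fin n))) : ℝ≥0∞ :=
  ⨆ M : ℝ≥0, (M : ℝ≥0∞) * volume {x ∈ Ω | (M : ℝ) < ‖ψ x‖} ^ (1 / p)

/-- The weak space `L^p_w(Ω)`, for vector fields. -/
def MemWeakLp {n : ℕ} (p : ℝ)
    (ψ : EuclideanSpace ℝ (Fin n) → EuclideanSpace ℝ (Fin n))
    (Ω : Set (EuclideanSpace ℝ (Fin n))) : Prop :=
  AEStronglyMeasurable ψ (volume.restrict Ω) ∧ weakLpNorm p ψ Ω < ⊤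

/-- `F` is the distributional gradient of `f` in the open set `Ω`: both are locally integrable
in `Ω`, and `∫ f ∂ᵢφ = - ∫ Fᵢ φ` for every `i` and every smooth `φ` with compact support in `Ω`. -/
structure HasWeakGradientOn {n : ℕ} (f : EuclideanSpace ℝ (Fin n) → ℝ)
    (F : EuclideanSpace ℝ (Fin n) → EuclideanSpace ℝ (Fin n))
    (Ω : Set (EuclideanSpace ℝ (Fin n))) : Prop where
  locallyIntegrableOn : LocallyIntegrableOn f Ω volume
  locallyIntegrableOn_gradient : LocallyIntegrableOn F Ω volume
  integral_eq : ∀ φ : EuclideanSpace ℝ (Fin n) → ℝ, ContDiff ℝ ∞ φ → HasCompactSupport φ →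
    tsupport φ ⊆ Ω → ∀ i : Fin n,
      ∫ x in Ω, f x * fderiv ℝ φ x (EuclideanSpace.single i (1 : ℝ)) = - ∫ x in Ω, F x i * φ x

end

end RootRegularity

namespace RootRegularity

open Set Filter Topology

/-! Write `s = k + α`. Where `g ≠ 0`, the function `f` is locally plus or minus the signed `s`-th
root of `g`, so `|∂ᵢ f| = (1/s) |g|^(1/s - 1) |∂ᵢ g|`. The question is how large the set is on which
this exceeds `M`.

The core is one-dimensional. On an interval where `g'` has no zero and `|g'| ≤ A`, the signed root
is injective. Where its slope exceeds `M`, its values are at most `(A/M)^(1/(s-1))` in modulus, so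
the steep set has measure at most `2 (A/M)^(1/(s-1)) / M` (`volume_steepSet_le_of_deriv_ne_zero`).
If only some derivative of order at most `k` is free of zeros, Rolle's theorem cuts the interval
into boundedly many such pieces. If instead every derivative of orders `1, …, k` vanishes somewhere,
then `|g'| ≤ H L^(s-1)` on the interval of length `L`. Inserted for `A`, this gives `(A/M)^(1/(s-1))
= (H/M)^(1/(s-1)) L`, which is linear in `L`. Such an interval can therefore be bisected without
loss (`volume_steepSet_inter_le_of_length_le`). The resulting decay is `M^(-1 - 1/(s-1)) = M^(-p)`.

In several variables, Fubini along coordinate segments gives the estimate on balls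
(`volume_mul_le_of_forall_slice`), and a finite cover gives it on compact sets. Since `p > 1`, the
pointwise gradient is locally integrable. It is the distributional one because `f` can be replaced
by truncations that vanish near its zeros (`hasWeakGradientOn_rootGradient`). -/

/-! ### The weak-type estimate on an interval -/

/-- The signed root `sign u * |u| ^ (1 / s)`, written as `u * |u| ^ (1 / s - 1)`. -/
noncomputable def signedRoot (s u : ℝ) : ℝ := u * |u| ^ (1 / s - 1)

lemma abs_signedRoot {s u : ℝ} (hu : u ≠ 0) : |signedRoot s u| = |u| ^ (1 / s) := by
  have h : 0 < |u| := abs_pos.2 hu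
  rw [signedRoot, abs_mul, abs_of_nonneg (Real.rpow_nonneg h.le _), Real.rpow_sub_one h.ne']
  field_simp

lemma signedRoot_injOn {s : ℝ} (hs : 0 < s) : InjOn (signedRoot s) {u | u ≠ 0} := by
  intro u hu v hv h
  have habs : |u| ^ (1 / s) = |v| ^ (1 / s) := by
    rw [← abs_signedRoot hu, ← abs_signedRoot hv, h]
  have huv : |u| = |v| :=
    (Real.rpow_left_inj (abs_nonneg u) (abs_nonneg v) (one_div_pos.2 hs).ne').1 habs
  have hpos : 0 < |v| ^ (1 / s - 1) := Real.rpow_pos_of_pos (abs_pos.2 hv) _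
  simp only [signedRoot, huv] at h
  exact mul_right_cancel₀ hpos.ne' h

lemma hasDerivAt_signedRoot {s u : ℝ} (hu : u ≠ 0) :
    HasDerivAt (signedRoot s) (1 / s * |u| ^ (1 / s - 1)) u := by
  have h : 0 < |u| := abs_pos.2 hu
  have h1 := (hasDerivAt_id u).mul
    ((hasDerivAt_abs hu).rpow_const (p := 1 / s - 1) (Or.inl h.ne'))
  refine h1.congr_deriv ?_
  rw [Real.rpow_sub_one h.ne' (1 / s - 1)]
  have h2 : u * (SignType.sign u : ℝ) = |u| := by
    rcases lt_or_gt_of_ne hu with h | h <;> simp [h, abs_of_neg, abs_of_pos]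
  simp only [id]
  calc _ = |u| ^ (1 / s - 1) + (u * (SignType.sign u : ℝ)) * (1 / s - 1)
            * (|u| ^ (1 / s - 1) / |u|) := by ring
    _ = _ := by rw [h2]; field_simp; ring

/-- The set on which `|g| ^ (1 / s)` is differentiable with a derivative larger than `M`. -/
def steepSet (s M : ℝ) (g g' : ℝ → ℝ) : Set ℝ :=
  {t | g t ≠ 0 ∧ M < 1 / s * |g t| ^ (1 / s - 1) * |g' t|}

lemma isOpen_steepSet_inter {s M a b : ℝ} {g g' : ℝ → ℝ} (hg : ContinuousOn g (Ioo a b))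
    (hg' : ContinuousOn g' (Ioo a b)) : IsOpen (steepSet s M g g' ∩ Ioo a b) := by
  have h1 : IsOpen (Ioo a b ∩ g ⁻¹' {0}ᶜ) :=
    hg.isOpen_inter_preimage isOpen_Ioo isOpen_compl_singleton
  have h2 : ContinuousOn (fun t => 1 / s * |g t| ^ (1 / s - 1) * |g' t|)
      (Ioo a b ∩ g ⁻¹' {0}ᶜ) := by
    refine (continuousOn_const.mul ?_).mul (hg'.mono inter_subset_left).abs
    exact (hg.mono inter_subset_left).abs.rpow_const
      fun t ht => Or.inl (abs_ne_zero.2 ht.2)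
  have h3 := h2.isOpen_inter_preimage h1 (isOpen_Ioi (a := M))
  convert h3 using 1
  ext t
  simp only [steepSet, mem_inter_iff, mem_ofPred_eq, mem_preimage, mem_Ioi, mem_compl_iff,
    mem_singleton_iff]
  tauto

/-- Where `|g| ^ (1 / s)` is steep, it is small. -/
lemma rpow_le_of_mem_steepSet {s M A t : ℝ} {g g' : ℝ → ℝ} (hs : 1 < s) (hM : 0 < M)
    (ht : t ∈ steepSet s M g g') (hA : |g' t| ≤ A) :
    |g t| ^ (1 / s) ≤ (A / M) ^ (1 / (s - 1)) := by
  obtain ⟨h0, h⟩ := ht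
  have hg : 0 < |g t| := abs_pos.2 h0
  have hs0 : 0 < s := by linarith
  have h1 : 1 / s * |g t| ^ (1 / s - 1) * |g' t| ≤ |g t| ^ (1 / s - 1) * A := by
    have : 1 / s * |g t| ^ (1 / s - 1) ≤ |g t| ^ (1 / s - 1) := by
      apply mul_le_of_le_one_left (by positivity)
      rw [div_le_one hs0]; exact hs.le
    gcongr
  have h2 : M ≤ |g t| ^ (1 / s - 1) * A := h.le.trans h1
  have h3 : |g t| ^ ((s - 1) / s) ≤ A / M := by
    rw [le_div_iff₀ hM]
    have : |g t| ^ ((s - 1) / s) * |g t| ^ (1 / s - 1) = 1 := by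
      rw [← Real.rpow_add hg, show (s - 1) / s + (1 / s - 1) = 0 by field_simp; ring,
        Real.rpow_zero]
    calc |g t| ^ ((s - 1) / s) * M ≤ |g t| ^ ((s - 1) / s) * (|g t| ^ (1 / s - 1) * A) := by
          gcongr
      _ = A := by rw [← mul_assoc, this, one_mul]
  have h4 : 0 < s - 1 := by linarith
  calc |g t| ^ (1 / s) = (|g t| ^ ((s - 1) / s)) ^ (1 / (s - 1)) := by
        rw [← Real.rpow_mul hg.le]; congr 1; field_simp
    _ ≤ _ := by gcongr

lemma injOn_Ioo_of_hasDerivAt_ne_zero {a b : ℝ} {g g' : ℝ → ℝ}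
    (hd : ∀ t ∈ Ioo a b, HasDerivAt g (g' t) t) (h0 : ∀ t ∈ Ioo a b, g' t ≠ 0) :
    InjOn g (Ioo a b) := by
  have key : ∀ x ∈ Ioo a b, ∀ y ∈ Ioo a b, x < y → g x ≠ g y := by
    intro x hx y hy hxy he
    have hsub : Icc x y ⊆ Ioo a b := fun t ht => ⟨hx.1.trans_le ht.1, ht.2.trans_lt hy.2⟩
    obtain ⟨c, hc, hc0⟩ := exists_hasDerivAt_eq_zero hxy
      (fun t ht => (hd t (hsub ht)).continuousAt.continuousWithinAt) he
      (fun t ht => hd t (hsub (Ioo_subset_Icc_self ht)))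
    exact h0 c (hsub (Ioo_subset_Icc_self hc)) hc0
  intro x hx y hy he
  by_contra hne
  rcases lt_or_gt_of_ne hne with h | h
  · exact key x hx y hy h he
  · exact key y hy x hx h he.symm

/-- Change of variables by `signedRoot s ∘ g`, which is injective here: its derivative exceeds `M`
in modulus on the steep set, and the image lies in an interval of length `2 (A / M) ^ (1 / (s -
1))`. -/
lemma volume_steepSet_le_of_deriv_ne_zero {s M A a b : ℝ} {g g' : ℝ → ℝ} (hs : 1 < s)
    (hM : 0 < M) (hd : ∀ t ∈ Ioo a b, HasDerivAt g (g' t) t)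
    (hc : ContinuousOn g' (Ioo a b)) (hA : ∀ t ∈ Ioo a b, |g' t| ≤ A)
    (h0 : ∀ t ∈ Ioo a b, g' t ≠ 0) :
    volume (steepSet s M g g' ∩ Ioo a b) ≤
      ENNReal.ofReal (2 * (A / M) ^ (1 / (s - 1)) / M) := by
  set E := steepSet s M g g' ∩ Ioo a b with hE
  have hmeas : MeasurableSet E := (isOpen_steepSet_inter
    (fun t ht => (hd t ht).continuousAt.continuousWithinAt) hc).measurableSet
  set U := (A / M) ^ (1 / (s - 1)) with hU
  have hder : ∀ t ∈ E, HasDerivWithinAt (fun t => signedRoot s (g t))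
      (1 / s * |g t| ^ (1 / s - 1) * g' t) E t := fun t ht =>
    ((hasDerivAt_signedRoot ht.1.1).comp t (hd t ht.2)).hasDerivWithinAt
  have hinj : InjOn (fun t => signedRoot s (g t)) E := fun x hx y hy h =>
    injOn_Ioo_of_hasDerivAt_ne_zero hd h0 hx.2 hy.2
      (signedRoot_injOn (by linarith) hx.1.1 hy.1.1 h)
  have key := lintegral_image_eq_lintegral_abs_deriv_mul hmeas hder hinj (fun _ => 1)
  simp only [lintegral_const, one_mul, mul_one, MeasurableSet.univ, Measure.restrict_apply,
    univ_inter] at key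
  have himg : volume ((fun t => signedRoot s (g t)) '' E) ≤ ENNReal.ofReal (2 * U) := by
    have : (fun t => signedRoot s (g t)) '' E ⊆ Icc (-U) U := by
      rintro _ ⟨t, ht, rfl⟩
      rw [mem_Icc, ← abs_le, abs_signedRoot ht.1.1]
      exact rpow_le_of_mem_steepSet hs hM ht.1 (hA t ht.2)
    refine (measure_mono this).trans ?_
    rw [Real.volume_Icc]
    apply ENNReal.ofReal_le_ofReal; linarith
  have hlow : ENNReal.ofReal M * volume E ≤
      ∫⁻ t in E, ENNReal.ofReal |1 / s * |g t| ^ (1 / s - 1) * g' t| := by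
    rw [← setLIntegral_const]
    refine setLIntegral_mono' hmeas fun t ht => ENNReal.ofReal_le_ofReal ?_
    rw [abs_mul, abs_of_nonneg (a := 1 / s * |g t| ^ (1 / s - 1)) (by positivity)]
    exact ht.1.2.le
  rw [← key] at hlow
  rw [ENNReal.ofReal_div_of_pos hM, ENNReal.le_div_iff_mul_le (Or.inl (by simpa using hM))
    (Or.inl ENNReal.ofReal_ne_top), mul_comm]
  exact hlow.trans himg

/-- The same estimate when a derivative `G (j + 1)` of `g` has no zeros: each derivation costs a
factor two, because the interval is cut at the zero of the preceding derivative. -/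
lemma volume_steepSet_le_of_iterated_deriv_ne_zero {s M A : ℝ} {G : ℕ → ℝ → ℝ} (hs : 1 < s)
    (hM : 0 < M) (j : ℕ) : ∀ a b : ℝ,
    (∀ i ≤ j, ∀ t ∈ Ioo a b, HasDerivAt (G i) (G (i + 1) t) t) →
    ContinuousOn (G 1) (Ioo a b) → (∀ t ∈ Ioo a b, |G 1 t| ≤ A) →
    (∀ t ∈ Ioo a b, G (j + 1) t ≠ 0) →
    volume (steepSet s M (G 0) (G 1) ∩ Ioo a b) ≤
      2 ^ j * ENNReal.ofReal (2 * (A / M) ^ (1 / (s - 1)) / M) := by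
  induction j with
  | zero =>
    intro a b hd hc hA h0
    simpa using volume_steepSet_le_of_deriv_ne_zero hs hM (hd 0 le_rfl) hc hA h0
  | succ j ih =>
    intro a b hd hc hA h0
    have hinj := injOn_Ioo_of_hasDerivAt_ne_zero (hd (j + 1) le_rfl) h0
    by_cases hz : ∃ c ∈ Ioo a b, G (j + 1) c = 0
    · obtain ⟨c, hcm, hc0⟩ := hz
      have hl : Ioo a c ⊆ Ioo a b := Ioo_subset_Ioo_right hcm.2.le
      have hr : Ioo c b ⊆ Ioo a b := Ioo_subset_Ioo_left hcm.1.le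
      have h1 := ih a c (fun i hi t ht => hd i (by lia) t (hl ht)) (hc.mono hl)
        (fun t ht => hA t (hl ht))
        (fun t ht h => ht.2.ne (hinj (hl ht) hcm (h.trans hc0.symm)))
      have h2 := ih c b (fun i hi t ht => hd i (by lia) t (hr ht)) (hc.mono hr)
        (fun t ht => hA t (hr ht))
        (fun t ht h => ht.1.ne' (hinj (hr ht) hcm (h.trans hc0.symm)))
      have hsub : steepSet s M (G 0) (G 1) ∩ Ioo a b ⊆ (steepSet s M (G 0) (G 1) ∩ Ioo a c) ∪
          ((steepSet s M (G 0) (G 1) ∩ Ioo c b) ∪ {c}) := by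
        rintro t ⟨hE, ht⟩
        rcases lt_trichotomy t c with h | h | h
        · exact Or.inl ⟨hE, ht.1, h⟩
        · exact Or.inr (Or.inr h)
        · exact Or.inr (Or.inl ⟨hE, h, ht.2⟩)
      calc _ ≤ _ := measure_mono hsub
        _ ≤ _ := (measure_union_le _ _).trans (add_le_add_right (measure_union_le _ _) _)
        _ ≤ _ := add_le_add h1 (add_le_add h2 (Real.volume_singleton).le)
        _ = _ := by rw [add_zero, pow_succ]; ring
    · push Not at hz
      refine (ih a b (fun i hi => hd i (by lia)) hc hA hz).trans ?_
      gcongr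
      · norm_num
      · lia

/-- If all derivatives of orders `1, …, k` vanish somewhere, then they are controlled by the
Hölder constant of the last one. -/
lemma abs_deriv_le_of_forall_exists_zero {k : ℕ} {α H a b : ℝ} {G : ℕ → ℝ → ℝ}
    (hα : 0 ≤ α) (hH : 0 ≤ H)
    (hd : ∀ i < k, ∀ t ∈ Ioo a b, HasDerivAt (G i) (G (i + 1) t) t)
    (hh : ∀ t ∈ Ioo a b, ∀ u ∈ Ioo a b, |G k t - G k u| ≤ H * |t - u| ^ α)
    (hz : ∀ j, 1 ≤ j → j ≤ k → ∃ c ∈ Ioo a b, G j c = 0) (i : ℕ) (hi : i < k) :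
    ∀ t ∈ Ioo a b, |G (k - i) t| ≤ H * (b - a) ^ ((i : ℝ) + α) := by
  have hlen : ∀ t ∈ Ioo a b, ∀ u ∈ Ioo a b, |t - u| ≤ b - a := fun t ht u hu => by
    rw [abs_le]; constructor <;> linarith [ht.1, ht.2, hu.1, hu.2]
  -- The induction descends from order `k`. Each step integrates from a zero of the next lower
  -- derivative and gains a factor `b - a`.
  induction i with
  | zero =>
    intro t ht
    obtain ⟨c, hc, hc0⟩ := hz k (by lia) le_rfl
    have h1 := hh t ht c hc
    rw [hc0, sub_zero] at h1
    simp only [Nat.sub_zero, Nat.cast_zero, zero_add]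
    refine h1.trans ?_
    gcongr
    exact hlen t ht c hc
  | succ i ih =>
    intro t ht
    obtain ⟨c, hc, hc0⟩ := hz (k - (i + 1)) (by lia) (by lia)
    have hab : 0 < b - a := by linarith [ht.1, ht.2]
    have h1 := Convex.norm_image_sub_le_of_norm_hasDerivWithin_le
      (f := G (k - (i + 1))) (f' := G (k - i)) (s := Ioo a b) (x := c) (y := t)
      (C := H * (b - a) ^ ((i : ℝ) + α))
      (fun x hx => by
        have := hd (k - (i + 1)) (by lia) x hx
        rw [show k - (i + 1) + 1 = k - i by lia] at this
        exact this.hasDerivWithinAt)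
      (fun x hx => ih (by lia) x hx) (convex_Ioo a b) hc ht
    rw [hc0, sub_zero, Real.norm_eq_abs, Real.norm_eq_abs] at h1
    calc _ ≤ _ := h1
      _ ≤ H * (b - a) ^ ((i : ℝ) + α) * (b - a) := by
          gcongr
          exact hlen t ht c hc
      _ = _ := by
          rw [mul_assoc, ← Real.rpow_add_one hab.ne']; push_cast; ring_nf

/-- Repeated bisection, stopped on the intervals on which some derivative has no zeros. -/
lemma volume_steepSet_inter_le_of_length_le {k : ℕ} (hk : 0 < k) {α H M ε δ : ℝ} (hα : 0 < α)
    (hH : 0 ≤ H) (hM : 0 < M) (hδε : H * δ ^ ((k : ℝ) + α - 1) < ε)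
    {G : ℕ → ℝ → ℝ} (d : ℕ) : ∀ a b A : ℝ, a ≤ b → b - a ≤ 2 ^ d * δ →
    (∀ i < k, ∀ t ∈ Ioo a b, HasDerivAt (G i) (G (i + 1) t) t) →
    ContinuousOn (G 1) (Ioo a b) →
    (∀ t ∈ Ioo a b, ∀ u ∈ Ioo a b, |G k t - G k u| ≤ H * |t - u| ^ α) →
    (∀ t ∈ Ioo a b, |G 1 t| ≤ A) →
    volume (steepSet (k + α) M (G 0) (G 1) ∩ {t | ε ≤ |G 1 t|} ∩ Ioo a b) ≤
      2 ^ k * ENNReal.ofReal (2 * max ((A / M) ^ (1 / ((k : ℝ) + α - 1)))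
        (2 * (H / M) ^ (1 / ((k : ℝ) + α - 1)) * (b - a)) / M) := by
  have hk1 : (1 : ℝ) ≤ k := by exact_mod_cast hk
  have hs : 1 < (k : ℝ) + α := by linarith
  have hs1 : 0 < (k : ℝ) + α - 1 := by linarith
  -- The stopping case: a derivative without zeros gives the first term of the maximum, and no
  -- further bisection is needed.
  have good : ∀ a b A : ℝ,
      (∀ i < k, ∀ t ∈ Ioo a b, HasDerivAt (G i) (G (i + 1) t) t) →
      ContinuousOn (G 1) (Ioo a b) → (∀ t ∈ Ioo a b, |G 1 t| ≤ A) →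
      (∃ j, 1 ≤ j ∧ j ≤ k ∧ ∀ c ∈ Ioo a b, G j c ≠ 0) →
      volume (steepSet (k + α) M (G 0) (G 1) ∩ {t | ε ≤ |G 1 t|} ∩ Ioo a b) ≤
      2 ^ k * ENNReal.ofReal (2 * max ((A / M) ^ (1 / ((k : ℝ) + α - 1)))
        (2 * (H / M) ^ (1 / ((k : ℝ) + α - 1)) * (b - a)) / M) := by
    rintro a b A hd hc hA ⟨j, hj1, hjk, hj⟩
    obtain ⟨i, rfl⟩ : ∃ i, j = i + 1 := ⟨j - 1, by lia⟩
    refine (measure_mono (inter_subset_inter_left _ inter_subset_left)).trans ?_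
    refine (volume_steepSet_le_of_iterated_deriv_ne_zero hs hM i a b
      (fun l hl => hd l (by lia)) hc hA hj).trans ?_
    gcongr
    · norm_num
    · lia
    · exact le_max_left _ _
  have bad : ∀ a b : ℝ,
      (∀ i < k, ∀ t ∈ Ioo a b, HasDerivAt (G i) (G (i + 1) t) t) →
      (∀ t ∈ Ioo a b, ∀ u ∈ Ioo a b, |G k t - G k u| ≤ H * |t - u| ^ α) →
      (¬ ∃ j, 1 ≤ j ∧ j ≤ k ∧ ∀ c ∈ Ioo a b, G j c ≠ 0) →
      ∀ t ∈ Ioo a b, |G 1 t| ≤ H * (b - a) ^ ((k : ℝ) + α - 1) := by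
    intro a b hd hh hz t ht
    push Not at hz
    have := abs_deriv_le_of_forall_exists_zero hα.le hH hd hh hz (k - 1) (by lia) t ht
    rw [show k - (k - 1) = 1 by lia, Nat.cast_sub hk, Nat.cast_one] at this
    rwa [show (k : ℝ) + α - 1 = k - 1 + α by ring]
  induction d with
  | zero =>
    intro a b A hab hlen hd hc hh hA
    by_cases hz : ∃ j, 1 ≤ j ∧ j ≤ k ∧ ∀ c ∈ Ioo a b, G j c ≠ 0
    · exact good a b A hd hc hA hz
    -- All derivatives vanish somewhere and the length is at most `δ`, so `|G 1| ≤ H * δ ^ (k + α -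
    -- 1) < ε` and nothing is left to measure.
    · have hemp : steepSet (k + α) M (G 0) (G 1) ∩ {t | ε ≤ |G 1 t|} ∩ Ioo a b = ∅ := by
        rw [eq_empty_iff_forall_notMem]
        rintro t ⟨⟨-, ht⟩, htI⟩
        have h1 := bad a b hd hh hz t htI
        have h2 : (b - a) ^ ((k : ℝ) + α - 1) ≤ δ ^ ((k : ℝ) + α - 1) := by
          apply Real.rpow_le_rpow (by linarith) (by simpa using hlen) hs1.le
        have h3 := mul_le_mul_of_nonneg_left h2 hH
        have h4 : ε ≤ |G 1 t| := ht
        linarith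
      rw [hemp]; simp
  | succ d ih =>
    intro a b A hab hlen hd hc hh hA
    by_cases hz : ∃ j, 1 ≤ j ∧ j ≤ k ∧ ∀ c ∈ Ioo a b, G j c ≠ 0
    · exact good a b A hd hc hA hz
    · have hb := bad a b hd hh hz
      set m := (a + b) / 2 with hm
      have hl : Ioo a m ⊆ Ioo a b := Ioo_subset_Ioo_right (by linarith)
      have hr : Ioo m b ⊆ Ioo a b := Ioo_subset_Ioo_left (by linarith)
      have hpow : (2 : ℝ) ^ (d + 1) * δ = 2 * (2 ^ d * δ) := by ring
      have h1 := ih a m (H * (b - a) ^ ((k : ℝ) + α - 1)) (by linarith) (by linarith)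
        (fun i hi t ht => hd i hi t (hl ht)) (hc.mono hl)
        (fun t ht u hu => hh t (hl ht) u (hl hu)) (fun t ht => hb t (hl ht))
      have h2 := ih m b (H * (b - a) ^ ((k : ℝ) + α - 1)) (by linarith) (by linarith)
        (fun i hi t ht => hd i hi t (hr ht)) (hc.mono hr)
        (fun t ht u hu => hh t (hr ht) u (hr hu)) (fun t ht => hb t (hr ht))
      have hba : 0 ≤ b - a := by linarith
      have hval : (H * (b - a) ^ ((k : ℝ) + α - 1) / M) ^ (1 / ((k : ℝ) + α - 1)) =
          (H / M) ^ (1 / ((k : ℝ) + α - 1)) * (b - a) := by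
        rw [mul_div_right_comm, Real.mul_rpow (by positivity) (by positivity),
          ← Real.rpow_mul hba, mul_one_div_cancel hs1.ne', Real.rpow_one]
      rw [hval, show m - a = (b - a) / 2 by rw [hm]; ring] at h1
      rw [hval, show b - m = (b - a) / 2 by rw [hm]; ring] at h2
      -- On each half the two terms of the maximum coincide, and the two halves add up to the second
      -- term for the whole interval. The constant thus does not grow with the depth of bisection;
      -- the factor 2 in that term is chosen for this.
      rw [show 2 * (H / M) ^ (1 / ((k : ℝ) + α - 1)) * ((b - a) / 2) =
        (H / M) ^ (1 / ((k : ℝ) + α - 1)) * (b - a) by ring, max_self] at h1 h2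
      set E := steepSet (k + α) M (G 0) (G 1) ∩ {t | ε ≤ |G 1 t|}
      have hsub : E ∩ Ioo a b ⊆ (E ∩ Ioo a m) ∪ ((E ∩ Ioo m b) ∪ {m}) := by
        rintro t ⟨hE, ht⟩
        rcases lt_trichotomy t m with h | h | h
        · exact Or.inl ⟨hE, ht.1, h⟩
        · exact Or.inr (Or.inr h)
        · exact Or.inr (Or.inl ⟨hE, h, ht.2⟩)
      set Y := (H / M) ^ (1 / ((k : ℝ) + α - 1)) * (b - a) with hY
      have hY0 : 0 ≤ Y := by positivity
      calc _ ≤ _ := measure_mono hsub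
        _ ≤ _ := (measure_union_le _ _).trans (add_le_add_right (measure_union_le _ _) _)
        _ ≤ _ := add_le_add h1 (add_le_add h2 (Real.volume_singleton).le)
        _ = 2 ^ k * ENNReal.ofReal (2 * (2 * Y) / M) := by
          rw [add_zero, ← mul_add, ← ENNReal.ofReal_add (by positivity) (by positivity)]
          congr 2; ring
        _ ≤ _ := by
          gcongr
          rw [hY, ← mul_assoc]
          exact le_max_right _ _

/-- The weak type estimate in dimension one for the derivative of the `(k + α)`-th root. -/
theorem volume_steepSet_inter_le {k : ℕ} (hk : 0 < k) {α H M : ℝ} (hα : 0 < α)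
    (hH : 0 ≤ H) (hM : 0 < M) {G : ℕ → ℝ → ℝ} {a b A : ℝ} (hab : a ≤ b)
    (hd : ∀ i < k, ∀ t ∈ Ioo a b, HasDerivAt (G i) (G (i + 1) t) t)
    (hc : ContinuousOn (G 1) (Ioo a b))
    (hh : ∀ t ∈ Ioo a b, ∀ u ∈ Ioo a b, |G k t - G k u| ≤ H * |t - u| ^ α)
    (hA : ∀ t ∈ Ioo a b, |G 1 t| ≤ A) :
    volume (steepSet (k + α) M (G 0) (G 1) ∩ Ioo a b) ≤
      2 ^ k * ENNReal.ofReal (2 * max ((A / M) ^ (1 / ((k : ℝ) + α - 1)))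
        (2 * (H / M) ^ (1 / ((k : ℝ) + α - 1)) * (b - a)) / M) := by
  have hk1 : (1 : ℝ) ≤ k := by exact_mod_cast hk
  have hs1 : 0 < (k : ℝ) + α - 1 := by linarith
  -- A lower bound on `|G 1|` makes the bisection terminate at a finite depth. The estimate does not
  -- depend on that bound, so it passes to the increasing union.
  set E : ℕ → Set ℝ := fun m =>
    steepSet (k + α) M (G 0) (G 1) ∩ {t | 1 / ((m : ℝ) + 1) ≤ |G 1 t|} ∩ Ioo a b with hE
  have hmono : Monotone E := by
    intro m l hml t ht
    have h1 : 1 / ((m : ℝ) + 1) ≤ |G 1 t| := ht.1.2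
    exact ⟨⟨ht.1.1, (Nat.one_div_le_one_div hml).trans h1⟩, ht.2⟩
  have hU : steepSet (k + α) M (G 0) (G 1) ∩ Ioo a b ⊆ ⋃ m, E m := by
    rintro t ⟨ht, htI⟩
    have h1 : 0 < |G 1 t| := by
      by_contra h
      have h0 : |G 1 t| = 0 := le_antisymm (not_lt.1 h) (abs_nonneg _)
      have := ht.2
      rw [h0, mul_zero] at this
      linarith
    obtain ⟨m, hm⟩ := exists_nat_one_div_lt h1
    exact mem_iUnion.2 ⟨m, ⟨ht, hm.le⟩, htI⟩
  refine (measure_mono hU).trans ?_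
  rw [hmono.measure_iUnion]
  refine iSup_le fun m => ?_
  have hε : (0 : ℝ) < 1 / ((m : ℝ) + 1) := Nat.one_div_pos_of_nat
  set ε := 1 / ((m : ℝ) + 1)
  -- With this `δ`, `H * δ ^ (k + α - 1) = H * ε / (H + 1) < ε`; the `+ 1` also covers `H = 0`.
  have hδ : 0 < (ε / (H + 1)) ^ (1 / ((k : ℝ) + α - 1)) := by positivity
  set δ := (ε / (H + 1)) ^ (1 / ((k : ℝ) + α - 1)) with hδd
  have hδε : H * δ ^ ((k : ℝ) + α - 1) < ε := by
    rw [hδd, ← Real.rpow_mul (by positivity), one_div_mul_cancel hs1.ne', Real.rpow_one,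
      ← mul_div_assoc, div_lt_iff₀ (by positivity)]
    nlinarith
  obtain ⟨d, hd'⟩ := pow_unbounded_of_one_lt ((b - a) / δ) (one_lt_two : (1 : ℝ) < 2)
  exact volume_steepSet_inter_le_of_length_le hk hα hH hM hδε d a b A hab
    ((div_lt_iff₀ hδ).1 hd').le hd hc hh hA

/-! ### Coordinate segments and the estimate on balls -/

variable {n : ℕ}

lemma partialDeriv_zero (s : Fin 0 → Fin n) (g : EuclideanSpace ℝ (Fin n) → ℝ)
    (x : EuclideanSpace ℝ (Fin n)) : partialDeriv s g x = g x := by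
  simp [partialDeriv]

lemma partialDeriv_one (s : Fin 1 → Fin n) (g : EuclideanSpace ℝ (Fin n) → ℝ)
    (x : EuclideanSpace ℝ (Fin n)) :
    partialDeriv s g x = fderiv ℝ g x (EuclideanSpace.single (s 0) (1 : ℝ)) := by
  simp [partialDeriv, iteratedFDeriv_one_apply]

lemma gradient_apply (g : EuclideanSpace ℝ (Fin n) → ℝ) (x : EuclideanSpace ℝ (Fin n))
    (i : Fin n) : (∇ g x) i = fderiv ℝ g x (EuclideanSpace.single i (1 : ℝ)) := by
  have h : inner ℝ (∇ g x) (EuclideanSpace.single i (1 : ℝ)) =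
      fderiv ℝ g x (EuclideanSpace.single i (1 : ℝ)) := by
    simp [gradient]
  rw [← h, EuclideanSpace.inner_single_right]
  simp

lemma hasDerivAt_partialDeriv_line {g : EuclideanSpace ℝ (Fin n) → ℝ} {k j : ℕ} (hj : j < k)
    {x : EuclideanSpace ℝ (Fin n)} {i : Fin n} {t : ℝ}
    (hg : ContDiffAt ℝ k g (x + t • EuclideanSpace.single i (1 : ℝ))) :
    HasDerivAt
      (fun u : ℝ => partialDeriv (fun _ : Fin j => i) g (x + u • EuclideanSpace.single i (1 : ℝ)))
      (partialDeriv (fun _ : Fin (j + 1) => i) g (x + t • EuclideanSpace.single i (1 : ℝ))) t := by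
  have h1 := (hg.differentiableAt_iteratedFDeriv (m := j) (by exact_mod_cast hj)).hasFDerivAt
  have h2 : HasDerivAt (fun u : ℝ => x + u • EuclideanSpace.single i (1 : ℝ))
      (EuclideanSpace.single i (1 : ℝ)) t := by
    simpa using ((hasDerivAt_id t).smul_const (EuclideanSpace.single i (1 : ℝ))).const_add x
  have h3 := h1.comp_hasDerivAt t h2
  have h4 := (ContinuousMultilinearMap.apply ℝ (fun _ : Fin j => EuclideanSpace ℝ (Fin n)) ℝ
    (fun _ => EuclideanSpace.single i (1 : ℝ))).hasFDerivAt.comp_hasDerivAt t h3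
  have h5 := iteratedFDeriv_succ_apply_left (𝕜 := ℝ) (f := g)
    (x := x + t • EuclideanSpace.single i (1 : ℝ))
    (fun _ : Fin (j + 1) => EuclideanSpace.single i (1 : ℝ))
  unfold partialDeriv
  rw [h5]
  exact h4

/-- The points at which the partial derivative `∂ᵢ` of `|g| ^ (1 / s)` is larger than `M`. -/
def steepSetPartial (s M : ℝ) (g : EuclideanSpace ℝ (Fin n) → ℝ) (i : Fin n) :
    Set (EuclideanSpace ℝ (Fin n)) :=
  {x | g x ≠ 0 ∧
    M < 1 / s * |g x| ^ (1 / s - 1) * |fderiv ℝ g x (EuclideanSpace.single i (1 : ℝ))|}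

lemma isOpen_steepSetPartial_inter {s M : ℝ} {g : EuclideanSpace ℝ (Fin n) → ℝ} {i : Fin n}
    {Ω : Set (EuclideanSpace ℝ (Fin n))} (hΩ : IsOpen Ω) (hg : ContDiffOn ℝ 1 g Ω) :
    IsOpen (steepSetPartial s M g i ∩ Ω) := by
  have hg' : ContinuousOn (fun x => fderiv ℝ g x (EuclideanSpace.single i (1 : ℝ))) Ω :=
    (hg.continuousOn_fderiv_of_isOpen hΩ le_rfl).clm_apply continuousOn_const
  have h1 : IsOpen (Ω ∩ g ⁻¹' {0}ᶜ) :=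
    hg.continuousOn.isOpen_inter_preimage hΩ isOpen_compl_singleton
  have h2 : ContinuousOn (fun x => 1 / s * |g x| ^ (1 / s - 1) *
      |fderiv ℝ g x (EuclideanSpace.single i (1 : ℝ))|) (Ω ∩ g ⁻¹' {0}ᶜ) := by
    refine (continuousOn_const.mul ?_).mul (hg'.mono inter_subset_left).abs
    exact (hg.continuousOn.mono inter_subset_left).abs.rpow_const
      fun t ht => Or.inl (abs_ne_zero.2 ht.2)
  have h3 := h2.isOpen_inter_preimage h1 (isOpen_Ioi (a := M))
  convert h3 using 1
  ext t
  simp only [steepSetPartial, mem_inter_iff, mem_ofPred_eq, mem_preimage, mem_Ioi, mem_compl_iff,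
    mem_singleton_iff]
  tauto

/-- A set inside a small ball is measured by its traces on segments of a fixed direction. -/
lemma volume_mul_le_of_forall_slice {S : Set (EuclideanSpace ℝ (Fin n))} (hS : MeasurableSet S)
    {c e : EuclideanSpace ℝ (Fin n)} (he : ‖e‖ = 1) {r : ℝ} (hSc : S ⊆ Metric.ball c r)
    {B : ℝ≥0∞}
    (hB : ∀ x ∈ Metric.ball c (2 * r), volume ({t : ℝ | x + t • e ∈ S} ∩ Ioo 0 r) ≤ B) :
    volume S * ENNReal.ofReal r ≤ B * volume (Metric.ball c (2 * r)) := by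
  have hmeas : Measurable (fun q : ℝ × EuclideanSpace ℝ (Fin n) =>
      S.indicator (fun _ => (1 : ℝ≥0∞)) (q.2 + q.1 • e)) :=
    (measurable_const.indicator hS).comp (by fun_prop)
  -- Integrating first in `x`, every translate contributes `volume S`, whence the factor `r`.
  -- Integrating first in `t`, only base points within `2 * r` of `c` contribute, since the segments
  -- have length `r`.
  have hswap := lintegral_lintegral_swap (μ := volume.restrict (Ioo (0 : ℝ) r))
    (ν := (volume : Measure (EuclideanSpace ℝ (Fin n))))
    (f := fun t x => S.indicator (fun _ => (1 : ℝ≥0∞)) (x + t • e)) hmeas.aemeasurable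
  have hleft : ∀ t : ℝ, ∫⁻ x : EuclideanSpace ℝ (Fin n),
      S.indicator (fun _ => (1 : ℝ≥0∞)) (x + t • e) = volume S := fun t => by
    rw [lintegral_add_right_eq_self (fun x => S.indicator (fun _ => (1 : ℝ≥0∞)) x) (t • e),
      lintegral_indicator_const hS, one_mul]
  simp only [hleft, lintegral_const, Measure.restrict_apply MeasurableSet.univ, univ_inter,
    Real.volume_Ioo, sub_zero] at hswap
  rw [hswap, ← setLIntegral_const, ← lintegral_indicator Metric.isOpen_ball.measurableSet]
  refine lintegral_mono fun x => ?_
  have hslice : ∫⁻ t in Ioo 0 r, S.indicator (fun _ => (1 : ℝ≥0∞)) (x + t • e) =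
      volume ({t : ℝ | x + t • e ∈ S} ∩ Ioo 0 r) := by
    have hm : MeasurableSet {t : ℝ | x + t • e ∈ S} :=
      (show Measurable (fun t : ℝ => x + t • e) by fun_prop) hS
    rw [← Measure.restrict_apply hm, ← lintegral_indicator_one hm]
    rfl
  rw [hslice]
  by_cases hx : x ∈ Metric.ball c (2 * r)
  · rw [indicator_of_mem hx]; exact hB x hx
  · rw [indicator_of_notMem hx]
    have : {t : ℝ | x + t • e ∈ S} ∩ Ioo 0 r = ∅ := by
      rw [eq_empty_iff_forall_notMem]
      rintro t ⟨ht, ht0, htr⟩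
      have h1 := hSc ht
      rw [Metric.mem_ball, dist_eq_norm] at h1 hx
      apply hx
      calc ‖x - c‖ = ‖(x + t • e - c) - t • e‖ := by congr 1; abel
        _ ≤ ‖x + t • e - c‖ + ‖t • e‖ := norm_sub_le _ _
        _ < r + r := by
          rw [norm_smul, he, mul_one, Real.norm_eq_abs, abs_of_pos ht0]; linarith
        _ = 2 * r := by ring
    simp [this]

/-- The weak type estimate for one partial derivative on a ball. -/
theorem volume_steepSetPartial_inter_ball_mul_le {k : ℕ} (hk : 0 < k) {α H A M r : ℝ}
    (hα : 0 < α) (hH : 0 ≤ H) (hM : 0 < M) (hr : 0 < r)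
    {g : EuclideanSpace ℝ (Fin n) → ℝ} {Ω : Set (EuclideanSpace ℝ (Fin n))} (hΩ : IsOpen Ω)
    (hg : ContDiffOn ℝ k g Ω) (i : Fin n)
    (hh : ∀ x ∈ Ω, ∀ y ∈ Ω, |partialDeriv (fun _ : Fin k => i) g x -
      partialDeriv (fun _ : Fin k => i) g y| ≤ H * ‖x - y‖ ^ α)
    (hA : ∀ x ∈ Ω, |fderiv ℝ g x (EuclideanSpace.single i (1 : ℝ))| ≤ A)
    {c : EuclideanSpace ℝ (Fin n)} (hc : Metric.ball c (3 * r) ⊆ Ω) :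
    volume (steepSetPartial (k + α) M g i ∩ Metric.ball c r) * ENNReal.ofReal r ≤
      2 ^ k * ENNReal.ofReal (2 * max ((A / M) ^ (1 / ((k : ℝ) + α - 1)))
        (2 * (H / M) ^ (1 / ((k : ℝ) + α - 1)) * r) / M) * volume (Metric.ball c (2 * r)) := by
  have hk1 : (1 : WithTop ℕ∞) ≤ k := by exact_mod_cast hk
  have hsub : Metric.ball c r ⊆ Ω := (Metric.ball_subset_ball (by linarith)).trans hc
  have he : ‖EuclideanSpace.single i (1 : ℝ)‖ = 1 := by simp
  have hg1 : ContDiffOn ℝ 1 g Ω := hg.of_le hk1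
  refine volume_mul_le_of_forall_slice
    (isOpen_steepSetPartial_inter Metric.isOpen_ball (hg1.mono hsub)).measurableSet he
    inter_subset_right fun x hx => ?_
  -- The radius `3 * r` is needed because segments of length `r` start anywhere in the ball of
  -- radius `2 * r`.
  have hline : ∀ t ∈ Ioo 0 r, x + t • EuclideanSpace.single i (1 : ℝ) ∈ Ω := by
    intro t ht
    apply hc
    rw [Metric.mem_ball, dist_eq_norm] at hx ⊢
    calc ‖x + t • EuclideanSpace.single i (1 : ℝ) - c‖
        = ‖(x - c) + t • EuclideanSpace.single i (1 : ℝ)‖ := by congr 1; abel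
      _ ≤ ‖x - c‖ + ‖t • EuclideanSpace.single i (1 : ℝ)‖ := norm_add_le _ _
      _ < 2 * r + r := by
        rw [norm_smul, he, mul_one, Real.norm_eq_abs, abs_of_pos ht.1]; linarith [ht.2]
      _ = 3 * r := by ring
  set G : ℕ → ℝ → ℝ := fun j t =>
    partialDeriv (fun _ : Fin j => i) g (x + t • EuclideanSpace.single i (1 : ℝ)) with hG
  have hG0 : ∀ t, G 0 t = g (x + t • EuclideanSpace.single i (1 : ℝ)) := fun t =>
    partialDeriv_zero _ _ _
  have hG1 : ∀ t, G 1 t = fderiv ℝ g (x + t • EuclideanSpace.single i (1 : ℝ))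
      (EuclideanSpace.single i (1 : ℝ)) := fun t => partialDeriv_one _ _ _
  have hcont : ContinuousOn (G 1) (Ioo 0 r) := by
    have h1 : ContinuousOn (fun x => fderiv ℝ g x (EuclideanSpace.single i (1 : ℝ))) Ω :=
      (hg1.continuousOn_fderiv_of_isOpen hΩ le_rfl).clm_apply continuousOn_const
    exact (h1.comp (f := fun t : ℝ => x + t • EuclideanSpace.single i (1 : ℝ))
      (by fun_prop) hline).congr fun t _ => hG1 t
  have key := volume_steepSet_inter_le hk hα hH hM (G := G) (a := 0) (b := r) (A := A) hr.le
    (fun j hj t ht => hasDerivAt_partialDeriv_line hj (hg.contDiffAt (hΩ.mem_nhds (hline t ht))))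
    hcont
    (fun t ht u hu => by
      refine (hh _ (hline t ht) _ (hline u hu)).trans_eq ?_
      congr 2
      rw [add_sub_add_left_eq_sub, ← sub_smul, norm_smul, he, mul_one, Real.norm_eq_abs])
    (fun t ht => by rw [hG1]; exact hA _ (hline t ht))
  rw [sub_zero] at key
  refine le_trans (measure_mono ?_) key
  rintro t ⟨⟨ht, -⟩, htI⟩
  refine ⟨?_, htI⟩
  have h2 := ht.2
  rw [← hG0, ← hG1] at h2
  exact ⟨by rw [hG0]; exact ht.1, h2⟩

/-! ### The pointwise gradient of the root and its weak norm -/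

/-- The gradient of a continuous `s`-th root `f` of `g`; it vanishes where `g` does. -/
noncomputable def rootGradient (s : ℝ) (f g : EuclideanSpace ℝ (Fin n) → ℝ)
    (x : EuclideanSpace ℝ (Fin n)) : EuclideanSpace ℝ (Fin n) :=
  (1 / s * (f x / g x)) • ∇ g x

lemma rootGradient_apply (s : ℝ) (f g : EuclideanSpace ℝ (Fin n) → ℝ)
    (x : EuclideanSpace ℝ (Fin n)) (i : Fin n) :
    rootGradient s f g x i =
      1 / s * (f x / g x) * fderiv ℝ g x (EuclideanSpace.single i (1 : ℝ)) := by
  simp [rootGradient, gradient_apply]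

lemma abs_eq_rpow_of_rpow_eq {s u v : ℝ} (hs : 0 < s) (h : |u| ^ s = |v|) :
    |u| = |v| ^ (1 / s) := by
  rw [← h, ← Real.rpow_mul (abs_nonneg u), mul_one_div_cancel hs.ne', Real.rpow_one]

lemma abs_rootGradient_apply {s : ℝ} (hs : 0 < s) {f g : EuclideanSpace ℝ (Fin n) → ℝ}
    {x : EuclideanSpace ℝ (Fin n)} (hx : |f x| ^ s = |g x|) (h0 : g x ≠ 0) (i : Fin n) :
    |rootGradient s f g x i| = 1 / s * |g x| ^ (1 / s - 1) *
      |fderiv ℝ g x (EuclideanSpace.single i (1 : ℝ))| := by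
  rw [rootGradient_apply, abs_mul, abs_mul, abs_div (f x), abs_eq_rpow_of_rpow_eq hs hx,
    Real.rpow_sub_one (abs_pos.2 h0).ne', abs_of_pos (one_div_pos.2 hs)]

lemma mem_steepSetPartial_of_lt {s M : ℝ} (hs : 0 < s) (hM : 0 ≤ M)
    {f g : EuclideanSpace ℝ (Fin n) → ℝ} {x : EuclideanSpace ℝ (Fin n)}
    (hx : |f x| ^ s = |g x|) {i : Fin n} (h : M < |rootGradient s f g x i|) :
    x ∈ steepSetPartial s M g i := by
  -- At a zero of `g` the quotient `f x / g x` is `0` by convention, so the component cannot exceed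
  -- `M ≥ 0`.
  have h0 : g x ≠ 0 := by
    intro h0
    rw [rootGradient_apply, h0] at h
    simp at h
    linarith
  refine ⟨h0, ?_⟩
  rwa [abs_rootGradient_apply hs hx h0] at h

lemma norm_le_sum_abs_apply (v : EuclideanSpace ℝ (Fin n)) : ‖v‖ ≤ ∑ i, |v i| := by
  rw [EuclideanSpace.norm_eq]
  refine Real.sqrt_le_iff.2 ⟨Finset.sum_nonneg fun i _ => abs_nonneg _, ?_⟩
  simp only [Real.norm_eq_abs]
  exact Finset.sum_sq_le_sq_sum_of_nonneg fun i _ => abs_nonneg _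

lemma exists_lt_abs_apply_of_lt_norm (hn : 0 < n) {M : ℝ} {v : EuclideanSpace ℝ (Fin n)} (h : M < ‖v‖) :
    ∃ i, M / n < |v i| := by
  by_contra! hv
  have h1 := norm_le_sum_abs_apply v
  have h2 : ∑ i, |v i| ≤ M := by
    calc _ ≤ ∑ _i : Fin n, M / n := Finset.sum_le_sum fun i _ => hv i
      _ = n * (M / n) := by simp
      _ ≤ M := by
        field_simp; rfl
  linarith

/-- Bounds for `g` in the coordinate directions: the Hölder constant of the pure derivatives of
order `k` is at most `H`, the first derivatives are at most `A`. -/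
structure PureDerivBounds (k : ℕ) (α H A : ℝ) (g : EuclideanSpace ℝ (Fin n) → ℝ)
    (Ω : Set (EuclideanSpace ℝ (Fin n))) : Prop where
  contDiffOn : ContDiffOn ℝ k g Ω
  nonneg_holder : 0 ≤ H
  nonneg_deriv : 0 ≤ A
  holder : ∀ i : Fin n, ∀ x ∈ Ω, ∀ y ∈ Ω, |partialDeriv (fun _ : Fin k => i) g x -
      partialDeriv (fun _ : Fin k => i) g y| ≤ H * ‖x - y‖ ^ α
  deriv : ∀ i : Fin n, ∀ x ∈ Ω, |fderiv ℝ g x (EuclideanSpace.single i (1 : ℝ))| ≤ A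

lemma div_rpow_div_eq {q A M : ℝ} (hA : 0 ≤ A) (hM : 0 < M) :
    (A / M) ^ q / M = A ^ q * M ^ (-(q + 1)) := by
  rw [Real.div_rpow hA hM.le, Real.rpow_neg hM.le, Real.rpow_add_one hM.ne']
  field_simp

/-- Both terms of the estimate carry the same power of `M`, so `H` and `A` separate from the
geometry. What remains depends only on `k`, `r` and the volume of a ball; this is why `D` can be
chosen before `α`. -/
theorem exists_volume_steepSetPartial_inter_ball_le {k : ℕ} (hk : 0 < k)
    {Ω : Set (EuclideanSpace ℝ (Fin n))} (hΩ : IsOpen Ω) {c : EuclideanSpace ℝ (Fin n)} {r : ℝ}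
    (hr : 0 < r) (hc : Metric.ball c (3 * r) ⊆ Ω) :
    ∃ D : ℝ≥0, ∀ α H A : ℝ, 0 < α → ∀ g : EuclideanSpace ℝ (Fin n) → ℝ,
      PureDerivBounds k α H A g Ω → ∀ (i : Fin n) (M : ℝ), 0 < M →
      volume (steepSetPartial (k + α) M g i ∩ Metric.ball c r) ≤
        D * ENNReal.ofReal (max (H ^ (1 / ((k : ℝ) + α - 1))) (A ^ (1 / ((k : ℝ) + α - 1))) *
          M ^ (-(1 / ((k : ℝ) + α - 1) + 1))) := by
  set D : ℝ≥0∞ := 2 ^ k * ENNReal.ofReal (2 * max 1 (2 * r)) * volume (Metric.ball c (2 * r)) /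
    ENNReal.ofReal r with hD
  have hr0 : ENNReal.ofReal r ≠ 0 := by simpa using hr
  have hDtop : D ≠ ⊤ := by
    refine ENNReal.div_ne_top (ENNReal.mul_ne_top (ENNReal.mul_ne_top ?_ ENNReal.ofReal_ne_top)
      measure_ball_lt_top.ne) hr0
    exact ENNReal.pow_ne_top (by norm_num)
  refine ⟨D.toNNReal, fun α H A hα g hg i M hM => ?_⟩
  rw [ENNReal.coe_toNNReal hDtop]
  have key := volume_steepSetPartial_inter_ball_mul_le hk hα hg.nonneg_holder hM hr hΩ
    hg.contDiffOn i (hg.holder i) (hg.deriv i) hc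
  set q := 1 / ((k : ℝ) + α - 1) with hq
  set X := max (H ^ q) (A ^ q) with hX
  have hX0 : 0 ≤ X := le_max_of_le_left (Real.rpow_nonneg hg.nonneg_holder _)
  have h1 : 2 * max ((A / M) ^ q) (2 * (H / M) ^ q * r) / M ≤
      2 * max 1 (2 * r) * (X * M ^ (-(q + 1))) := by
    have hMp : 0 ≤ M ^ (-(q + 1)) := Real.rpow_nonneg hM.le _
    have hHq : 0 ≤ H ^ q := Real.rpow_nonneg hg.nonneg_holder _
    have hAq : 0 ≤ A ^ q := Real.rpow_nonneg hg.nonneg_deriv _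
    rw [mul_div_assoc, mul_assoc 2 (max 1 (2 * r)), ← max_div_div_right hM.le ((A / M) ^ q)]
    refine mul_le_mul_of_nonneg_left (max_le ?_ ?_) zero_le_two
    · rw [div_rpow_div_eq hg.nonneg_deriv hM, ← one_mul (A ^ q * _)]
      gcongr
      · exact le_max_left _ _
      · exact le_max_right _ _
    · rw [show 2 * (H / M) ^ q * r / M = 2 * r * ((H / M) ^ q / M) by ring,
        div_rpow_div_eq hg.nonneg_holder hM]
      gcongr
      · exact le_max_right _ _
      · exact le_max_left _ _
  rw [hD, ENNReal.div_eq_inv_mul, mul_assoc, ← ENNReal.div_eq_inv_mul,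
    ENNReal.le_div_iff_mul_le (Or.inl hr0) (Or.inl ENNReal.ofReal_ne_top)]
  refine key.trans ?_
  calc _ ≤ 2 ^ k * ENNReal.ofReal (2 * max 1 (2 * r) * (X * M ^ (-(q + 1)))) *
        volume (Metric.ball c (2 * r)) := by gcongr
    _ = _ := by
      rw [ENNReal.ofReal_mul (by positivity)]; ring

/-- A vector longer than `M` has a component larger than `M / n`, and finitely many of the good
balls cover `K`; the constants are summed over balls and directions. -/
theorem exists_volume_lt_norm_rootGradient_le (hn : 0 < n) {k : ℕ} (hk : 0 < k)
    {Ω K : Set (EuclideanSpace ℝ (Fin n))} (hΩ : IsOpen Ω) (hK : IsCompact K) (hKΩ : K ⊆ Ω) :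
    ∃ D : ℝ≥0, ∀ α H A : ℝ, 0 < α → ∀ f g : EuclideanSpace ℝ (Fin n) → ℝ,
      PureDerivBounds k α H A g Ω → (∀ x ∈ Ω, |f x| ^ ((k : ℝ) + α) = |g x|) →
      ∀ M : ℝ, 0 < M →
      volume {x ∈ K | M < ‖rootGradient (k + α) f g x‖} ≤
        D * ENNReal.ofReal (max (H ^ (1 / ((k : ℝ) + α - 1))) (A ^ (1 / ((k : ℝ) + α - 1))) *
          (M / n) ^ (-(1 / ((k : ℝ) + α - 1) + 1))) := by
  have hball : ∀ x ∈ Ω, ∃ r : ℝ, 0 < r ∧ Metric.ball x (3 * r) ⊆ Ω := by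
    intro x hx
    obtain ⟨r, hr, h⟩ := Metric.isOpen_iff.1 hΩ x hx
    exact ⟨r / 3, by linarith, by rwa [mul_div_cancel₀ r (by norm_num)]⟩
  choose! r hr hrΩ using hball
  -- The condition `x ∈ Ω` sits behind the existential so that `D` is a total function, with the
  -- irrelevant value `0` off `Ω`.
  have hloc : ∀ x : EuclideanSpace ℝ (Fin n), ∃ D : ℝ≥0, x ∈ Ω → ∀ α H A : ℝ, 0 < α →
      ∀ g : EuclideanSpace ℝ (Fin n) → ℝ, PureDerivBounds k α H A g Ω →
      ∀ (i : Fin n) (M : ℝ), 0 < M →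
      volume (steepSetPartial (k + α) M g i ∩ Metric.ball x (r x)) ≤
        D * ENNReal.ofReal (max (H ^ (1 / ((k : ℝ) + α - 1))) (A ^ (1 / ((k : ℝ) + α - 1))) *
          M ^ (-(1 / ((k : ℝ) + α - 1) + 1))) := by
    intro x
    by_cases hx : x ∈ Ω
    · obtain ⟨D, hD⟩ := exists_volume_steepSetPartial_inter_ball_le hk hΩ (hr x hx) (hrΩ x hx)
      exact ⟨D, fun _ => hD⟩
    · exact ⟨0, fun h => absurd h hx⟩
  choose D hD using hloc
  obtain ⟨t, htK, hcov⟩ := hK.elim_nhds_subcover (fun x => Metric.ball x (r x))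
    (fun x hx => Metric.ball_mem_nhds x (hr x (hKΩ hx)))
  refine ⟨∑ x ∈ t, ∑ _i : Fin n, D x, fun α H A hα f g hg hfg M hM => ?_⟩
  have hMn : 0 < M / n := div_pos hM (by exact_mod_cast hn)
  have hs : 0 < (k : ℝ) + α := by positivity
  have hsub : {x ∈ K | M < ‖rootGradient (k + α) f g x‖} ⊆
      ⋃ x ∈ t, ⋃ i : Fin n, steepSetPartial (k + α) (M / n) g i ∩ Metric.ball x (r x) := by
    rintro y ⟨hyK, hy⟩
    obtain ⟨x, hx, hyx⟩ := mem_iUnion₂.1 (hcov hyK)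
    obtain ⟨i, hi⟩ := exists_lt_abs_apply_of_lt_norm hn hy
    exact mem_iUnion₂.2 ⟨x, hx, mem_iUnion.2
      ⟨i, mem_steepSetPartial_of_lt hs hMn.le (hfg y (hKΩ hyK)) hi, hyx⟩⟩
  refine (measure_mono hsub).trans ((measure_biUnion_finset_le _ _).trans ?_)
  push_cast
  rw [Finset.sum_mul]
  refine Finset.sum_le_sum fun x hx => ?_
  refine (measure_iUnion_fintype_le _ _).trans ?_
  rw [Finset.sum_mul]
  exact Finset.sum_le_sum fun i _ => hD x (hKΩ (htK x hx)) α H A hα g hg i _ hMn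

/-- The weak norm estimate, with real bounds. -/
theorem exists_weakLpNorm_rootGradient_le (hn : 0 < n) {k : ℕ} (hk : 0 < k)
    {Ω K : Set (EuclideanSpace ℝ (Fin n))} (hΩ : IsOpen Ω) (hK : IsCompact K) (hKΩ : K ⊆ Ω) :
    ∃ C : ℝ≥0, ∀ α H A p : ℝ, 0 < α → 1 / p + 1 / ((k : ℝ) + α) = 1 →
      ∀ f g : EuclideanSpace ℝ (Fin n) → ℝ,
      PureDerivBounds k α H A g Ω → (∀ x ∈ Ω, |f x| ^ ((k : ℝ) + α) = |g x|) →
      weakLpNorm p (rootGradient (k + α) f g) K ≤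
        C * ENNReal.ofReal (max (H ^ (1 / ((k : ℝ) + α))) (A ^ (1 / ((k : ℝ) + α)))) := by
  obtain ⟨D, hD⟩ := exists_volume_lt_norm_rootGradient_le hn hk hΩ hK hKΩ
  -- The factor `n` undoes `M / n`. Since `0 < 1 / p ≤ 1`, `max 1 D` dominates `D ^ (1 / p)` for all
  -- `p` at once, so the constant is independent of `α`.
  refine ⟨n * max 1 D, fun α H A p hα hp f g hg hfg => iSup_le fun M => ?_⟩
  have hk1 : (1 : ℝ) ≤ k := by exact_mod_cast hk
  set s := (k : ℝ) + α with hs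
  have hs1 : 1 < s := by linarith
  have hs0 : 0 < s := by linarith
  have hsm : 0 < s - 1 := by linarith
  have hp1 : 1 / p = (s - 1) / s := by
    rw [eq_sub_of_add_eq hp]; field_simp
  have hp0 : 0 < 1 / p := by rw [hp1]; positivity
  have hple : 1 / p ≤ 1 := by rw [hp1, div_le_one hs0]; linarith
  rcases eq_or_ne M 0 with rfl | hM0
  · simp
  have hM : (0 : ℝ) < M := by positivity
  have hn' : (0 : ℝ) < n := by exact_mod_cast hn
  have hMn : 0 < (M : ℝ) / n := by positivity
  have h1 := hD α H A hα f g hg hfg M hM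
  have hH0 := hg.nonneg_holder
  have hA0 := hg.nonneg_deriv
  set q := 1 / (s - 1) with hq
  -- Here `p = q + 1`: taking the `p`-th root turns the exponent `q` into `1 / s` and the power of
  -- `M` into `M⁻¹`, which cancels the weight.
  have hqp : q * (1 / p) = 1 / s := by rw [hp1, hq]; field_simp
  have hqp1 : -(q + 1) * (1 / p) = -1 := by
    rw [neg_mul, add_mul, hqp, hp1]; field_simp; ring
  have hmax : (max (H ^ q) (A ^ q)) ^ (1 / p) = max (H ^ (1 / s)) (A ^ (1 / s)) := by
    have hmono : MonotoneOn (fun x : ℝ => x ^ (1 / p)) (Ici 0) := fun x hx y _ hxy =>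
      Real.rpow_le_rpow hx hxy hp0.le
    have := hmono.map_max (a := H ^ q) (b := A ^ q) (Real.rpow_nonneg hH0 _)
      (Real.rpow_nonneg hA0 _)
    rw [this, ← Real.rpow_mul hH0, ← Real.rpow_mul hA0, hqp]
  have hX0 : 0 ≤ max (H ^ q) (A ^ q) := le_max_of_le_left (Real.rpow_nonneg hH0 _)
  have hDle : (D : ℝ≥0∞) ^ (1 / p) ≤ (max 1 D : ℝ≥0) := by
    rw [← ENNReal.coe_rpow_of_nonneg _ hp0.le, ENNReal.coe_le_coe]
    calc D ^ (1 / p) ≤ (max 1 D) ^ (1 / p) := NNReal.rpow_le_rpow (le_max_right _ _) hp0.le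
      _ ≤ (max 1 D) ^ (1 : ℝ) := NNReal.rpow_le_rpow_of_exponent_le (le_max_left _ _) hple
      _ = max 1 D := NNReal.rpow_one _
  calc (M : ℝ≥0∞) * volume {x ∈ K | (M : ℝ) < ‖rootGradient s f g x‖} ^ (1 / p)
      ≤ M * (D * ENNReal.ofReal (max (H ^ q) (A ^ q) * ((M : ℝ) / n) ^ (-(q + 1)))) ^ (1 / p) := by
        gcongr
    _ = D ^ (1 / p) * (M * ENNReal.ofReal (max (H ^ (1 / s)) (A ^ (1 / s)) * (n / M))) := by
        rw [ENNReal.mul_rpow_of_nonneg _ _ hp0.le, ENNReal.ofReal_rpow_of_nonneg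
          (by positivity) hp0.le, Real.mul_rpow hX0 (by positivity), hmax,
          ← Real.rpow_mul hMn.le, hqp1, Real.rpow_neg_one, inv_div]
        ring
    _ = D ^ (1 / p) * (n * ENNReal.ofReal (max (H ^ (1 / s)) (A ^ (1 / s)))) := by
        congr 1
        rw [← ENNReal.ofReal_coe_nnreal, ← ENNReal.ofReal_mul hM.le, ← ENNReal.ofReal_natCast n,
          ← ENNReal.ofReal_mul hn'.le]
        congr 1; field_simp
    _ ≤ (max 1 D : ℝ≥0) * (n * ENNReal.ofReal (max (H ^ (1 / s)) (A ^ (1 / s)))) := by gcongr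
    _ = _ := by push_cast; ring

lemma continuousOn_gradient {g : EuclideanSpace ℝ (Fin n) → ℝ}
    {Ω : Set (EuclideanSpace ℝ (Fin n))} (hΩ : IsOpen Ω) (hg : ContDiffOn ℝ 1 g Ω) :
    ContinuousOn (∇ g) Ω :=
  (InnerProductSpace.toDual ℝ (EuclideanSpace ℝ (Fin n))).symm.continuous.comp_continuousOn
    (hg.continuousOn_fderiv_of_isOpen hΩ le_rfl)

lemma aestronglyMeasurable_rootGradient {s : ℝ} {f g : EuclideanSpace ℝ (Fin n) → ℝ}
    {Ω : Set (EuclideanSpace ℝ (Fin n))} (hΩ : IsOpen Ω) (hf : ContinuousOn f Ω)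
    (hg : ContDiffOn ℝ 1 g Ω) :
    AEStronglyMeasurable (rootGradient s f g) (volume.restrict Ω) := by
  have h1 := hf.aemeasurable hΩ.measurableSet (μ := volume)
  have h2 := hg.continuousOn.aemeasurable hΩ.measurableSet (μ := volume)
  have h3 := (continuousOn_gradient hΩ hg).aestronglyMeasurable hΩ.measurableSet (μ := volume)
  exact ((h1.div h2).const_mul (1 / s)).aestronglyMeasurable.smul h3

/-- A function in a weak `L^p` space, `p > 1`, is integrable on sets of finite measure. -/
lemma integrable_of_meas_lt_le_rpow {β : Type*} [MeasurableSpace β] {μ : Measure β}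
    [IsFiniteMeasure μ] {E : Type*} [NormedAddCommGroup E] {F : β → E}
    (hF : AEStronglyMeasurable F μ) {C p : ℝ} (hp : 1 < p)
    (h : ∀ M : ℝ, 0 < M → μ {x | M < ‖F x‖} ≤ ENNReal.ofReal (C * M ^ (-p))) :
    Integrable F μ := by
  refine ⟨hF, ?_⟩
  -- Layer-cake formula, split at level `1`: finite total mass controls the low levels, the
  -- integrable tail `t ^ (-p)` the high ones.
  rw [hasFiniteIntegral_iff_norm, lintegral_eq_lintegral_meas_lt μ
    (Eventually.of_forall fun x => norm_nonneg _) hF.norm.aemeasurable,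
    ← Ioc_union_Ioi_eq_Ioi (zero_le_one' ℝ)]
  refine (lintegral_union_le _ _ _).trans_lt (ENNReal.add_lt_top.2 ⟨?_, ?_⟩)
  · refine (setLIntegral_mono' measurableSet_Ioc
      fun t _ => measure_mono (subset_univ _)).trans_lt ?_
    rw [setLIntegral_const, Real.volume_Ioc]
    exact ENNReal.mul_lt_top (measure_lt_top _ _) ENNReal.ofReal_lt_top
  · refine (setLIntegral_mono' measurableSet_Ioi
      fun t ht => h t (zero_lt_one.trans ht)).trans_lt ?_
    exact ((integrableOn_Ioi_rpow_of_lt (by linarith : -p < -1) zero_lt_one).const_mul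
      C).lintegral_lt_top

theorem integrableOn_rootGradient (hn : 0 < n) {k : ℕ} (hk : 0 < k) {α H A : ℝ} (hα : 0 < α)
    {Ω K : Set (EuclideanSpace ℝ (Fin n))} (hΩ : IsOpen Ω) (hK : IsCompact K) (hKΩ : K ⊆ Ω)
    {f g : EuclideanSpace ℝ (Fin n) → ℝ} (hf : ContinuousOn f Ω)
    (hg : PureDerivBounds k α H A g Ω) (hfg : ∀ x ∈ Ω, |f x| ^ ((k : ℝ) + α) = |g x|) :
    IntegrableOn (rootGradient (k + α) f g) K := by
  have hk1 : (1 : WithTop ℕ∞) ≤ k := by exact_mod_cast hk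
  have hkr : (1 : ℝ) ≤ k := by exact_mod_cast hk
  obtain ⟨D, hD⟩ := exists_volume_lt_norm_rootGradient_le hn hk hΩ hK hKΩ
  have hfin : IsFiniteMeasure (volume.restrict K) := ⟨by simpa using hK.measure_lt_top⟩
  have hq : 0 < 1 / ((k : ℝ) + α - 1) := one_div_pos.2 (by linarith)
  have hn' : (0 : ℝ) < n := by exact_mod_cast hn
  set q := 1 / ((k : ℝ) + α - 1)
  refine integrable_of_meas_lt_le_rpow (p := q + 1)
    (C := D * (max (H ^ q) (A ^ q) * ((n : ℝ)⁻¹) ^ (-(q + 1))))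
    ((aestronglyMeasurable_rootGradient hΩ hf (hg.contDiffOn.of_le hk1)).mono_measure
      (Measure.restrict_mono hKΩ le_rfl)) (by linarith) fun M hM => ?_
  rw [Measure.restrict_apply' hK.measurableSet]
  have h1 := hD α H A hα f g hg hfg M hM
  rw [show 1 / ((k : ℝ) + α - 1) = q from rfl] at h1
  have hset : {x | M < ‖rootGradient (k + α) f g x‖} ∩ K =
      {x ∈ K | M < ‖rootGradient (k + α) f g x‖} := by
    ext x; exact and_comm
  rw [hset]
  refine h1.trans_eq ?_
  rw [← ENNReal.ofReal_coe_nnreal, ← ENNReal.ofReal_mul D.coe_nonneg]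
  congr 1
  rw [div_eq_mul_inv M, Real.mul_rpow hM.le (by positivity)]
  ring

/-! ### Truncation and the distributional gradient -/

/-- A continuous cutoff that vanishes for `|v| ≤ ε` and is `1` for `|v| ≥ 2 * ε`. -/
noncomputable def cutoff (ε v : ℝ) : ℝ := min 1 (max 0 (|v| / ε - 1))

lemma continuous_cutoff (ε : ℝ) : Continuous (cutoff ε) := by
  unfold cutoff; fun_prop

lemma abs_cutoff_le (ε v : ℝ) : |cutoff ε v| ≤ 1 := by
  rw [abs_of_nonneg (le_min zero_le_one (le_max_left _ _))]
  exact min_le_left _ _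

lemma cutoff_eq_zero {ε v : ℝ} (hε : 0 < ε) (hv : |v| ≤ ε) : cutoff ε v = 0 := by
  have : |v| / ε - 1 ≤ 0 := by rw [sub_nonpos, div_le_one hε]; exact hv
  rw [cutoff, max_eq_left this]; simp

lemma tendsto_cutoff {v : ℝ} (hv : v ≠ 0) :
    Tendsto (fun m : ℕ => cutoff (1 / ((m : ℝ) + 1)) v) atTop (𝓝 1) := by
  refine tendsto_const_nhds.congr' ?_
  have h := (tendsto_one_div_add_atTop_nhds_zero_nat (𝕜 := ℝ)).eventually_lt_const
    (half_pos (abs_pos.2 hv))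
  filter_upwards [h] with m hm
  have hpos : (0 : ℝ) < 1 / ((m : ℝ) + 1) := Nat.one_div_pos_of_nat
  set ε := 1 / ((m : ℝ) + 1)
  have : 1 ≤ |v| / ε - 1 := by
    rw [le_sub_iff_add_le, le_div_iff₀ hpos]; linarith
  rw [cutoff, min_eq_left (this.trans (le_max_right _ _))]

/-- A `C^1` approximation of the identity that vanishes near zero. -/
noncomputable def truncation (ε u : ℝ) : ℝ := ∫ v in (0 : ℝ)..u, cutoff ε v

lemma hasDerivAt_truncation (ε u : ℝ) : HasDerivAt (truncation ε) (cutoff ε u) u :=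
  ((continuous_cutoff ε).integral_hasStrictDerivAt 0 u).hasDerivAt

lemma abs_truncation_le (ε u : ℝ) : |truncation ε u| ≤ |u| := by
  have := intervalIntegral.norm_integral_le_of_norm_le_const (a := 0) (b := u) (C := 1)
    (f := cutoff ε) fun v _ => abs_cutoff_le ε v
  simpa [truncation] using this

lemma truncation_eq_zero {ε u : ℝ} (hε : 0 < ε) (hu : |u| ≤ ε) : truncation ε u = 0 := by
  rw [truncation, intervalIntegral.integral_congr (g := fun _ => 0), intervalIntegral.integral_zero]
  intro v hv
  refine cutoff_eq_zero hε (le_trans ?_ hu)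
  simpa using abs_sub_left_of_mem_uIcc hv

lemma tendsto_truncation (u : ℝ) :
    Tendsto (fun m : ℕ => truncation (1 / ((m : ℝ) + 1)) u) atTop (𝓝 u) := by
  have h := intervalIntegral.tendsto_integral_filter_of_dominated_convergence
    (μ := volume) (a := 0) (b := u) (l := atTop)
    (F := fun (m : ℕ) v => cutoff (1 / ((m : ℝ) + 1)) v) (f := fun _ => (1 : ℝ)) (fun _ => 1)
    (Eventually.of_forall fun m => (continuous_cutoff _).aestronglyMeasurable)
    (Eventually.of_forall fun m => Eventually.of_forall fun v _ => abs_cutoff_le _ v)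
    (by simp)
    ((Measure.ae_ne volume 0).mono fun v hv _ => tendsto_cutoff hv)
  simpa [truncation] using h

/-- The equation fixes `f` only up to sign. By continuity the sign of `f` relative to `signedRoot s
∘ g` is constant near a point where `f ≠ 0`, so the chain rule applies; `f / g` absorbs that sign.
-/
lemma hasFDerivAt_root {s : ℝ} (hs : 0 < s) {f g : EuclideanSpace ℝ (Fin n) → ℝ}
    {x : EuclideanSpace ℝ (Fin n)} (hf : ContinuousAt f x) (hg : DifferentiableAt ℝ g x)
    (hfg : ∀ᶠ y in 𝓝 x, |f y| ^ s = |g y|) (h0 : f x ≠ 0) :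
    HasFDerivAt f ((1 / s * (f x / g x)) • fderiv ℝ g x) x := by
  have habs : ∀ y, |f y| ^ s = |g y| → f y ≠ 0 → g y ≠ 0 := fun y hy hy0 h => by
    rw [h, abs_zero, Real.rpow_eq_zero (abs_nonneg _) hs.ne'] at hy
    exact hy0 (abs_eq_zero.1 hy)
  have hgx : g x ≠ 0 := habs x hfg.self_of_nhds h0
  have hroot : ∀ y, |f y| ^ s = |g y| → g y ≠ 0 → |f y| = |signedRoot s (g y)| :=
    fun y hy hy0 => by rw [abs_signedRoot hy0, abs_eq_rpow_of_rpow_eq hs hy]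
  have hRc : ContinuousAt (fun y => signedRoot s (g y)) x :=
    (hasDerivAt_signedRoot hgx).continuousAt.comp hg.continuousAt
  have hR0 : signedRoot s (g x) ≠ 0 := by
    rw [← abs_ne_zero, ← hroot x hfg.self_of_nhds hgx]; exact abs_ne_zero.2 h0
  set σ := f x / signedRoot s (g x) with hσ
  have hσ1 : |σ| = 1 := by
    rw [hσ, abs_div, hroot x hfg.self_of_nhds hgx, div_self (abs_ne_zero.2 hR0)]
  have hprod : ∀ᶠ y in 𝓝 x, 0 < σ * (f y * signedRoot s (g y)) := by
    have hc : ContinuousAt (fun y => σ * (f y * signedRoot s (g y))) x :=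
      continuousAt_const.mul (hf.mul hRc)
    refine hc.eventually (lt_mem_nhds ?_)
    have : σ * (f x * signedRoot s (g x)) = f x ^ 2 := by rw [hσ]; field_simp
    simp only [this]; positivity
  have heq : f =ᶠ[𝓝 x] fun y => σ * signedRoot s (g y) := by
    filter_upwards [hprod, hfg] with y hy1 hy2
    have hfy : f y ≠ 0 := by rintro h; simp [h] at hy1
    have hgy := habs y hy2 hfy
    have h1 := hroot y hy2 hgy
    have h2 : |f y| = |σ * signedRoot s (g y)| := by rw [abs_mul, hσ1, one_mul, h1]
    rcases abs_eq_abs.1 h2 with h | h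
    · exact h
    · exfalso
      rw [h] at hy1
      nlinarith [sq_nonneg (σ * signedRoot s (g y))]
  have hd := ((hasDerivAt_signedRoot (s := s) hgx).comp_hasFDerivAt x hg.hasFDerivAt).const_mul σ
  have hd' : HasFDerivAt f (σ • ((1 / s * |g x| ^ (1 / s - 1)) • fderiv ℝ g x)) x :=
    hd.congr_of_eventuallyEq heq
  convert hd' using 1
  rw [smul_smul]
  congr 1
  have hpos : |g x| ^ (1 / s - 1) ≠ 0 := (Real.rpow_pos_of_pos (abs_pos.2 hgx) _).ne'
  have hfx : f x = σ * (g x * |g x| ^ (1 / s - 1)) := heq.self_of_nhds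
  rw [hfx]; field_simp

/-- At a zero of `f`, where `f` itself may fail to be differentiable, the truncated function
vanishes in a whole neighbourhood. -/
lemma hasFDerivAt_truncation_root {s ε : ℝ} (hs : 0 < s) (hε : 0 < ε)
    {f g : EuclideanSpace ℝ (Fin n) → ℝ} {x : EuclideanSpace ℝ (Fin n)} (hf : ContinuousAt f x)
    (hg : DifferentiableAt ℝ g x) (hfg : ∀ᶠ y in 𝓝 x, |f y| ^ s = |g y|) :
    HasFDerivAt (fun y => truncation ε (f y))
      (cutoff ε (f x) • (1 / s * (f x / g x)) • fderiv ℝ g x) x := by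
  by_cases h0 : f x = 0
  · rw [h0, cutoff_eq_zero hε (by simpa using hε.le), zero_smul]
    have hsmall : ∀ᶠ y in 𝓝 x, |f y| < ε :=
      hf.abs.eventually (gt_mem_nhds (by simpa [h0] using hε))
    exact (hasFDerivAt_const (0 : ℝ) x).congr_of_eventuallyEq
      (hsmall.mono fun y hy => truncation_eq_zero hε hy.le)
  · exact (hasDerivAt_truncation ε (f x)).comp_hasFDerivAt x (hasFDerivAt_root hs hf hg hfg h0)

/-- The truncations of `f` are differentiable throughout `Ω`, so they can be integrated by parts
against `φ`. Dominated convergence removes the truncation, with local integrability of the gradient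
supplying the majorant. -/
theorem hasWeakGradientOn_rootGradient (hn : 0 < n) {k : ℕ} (hk : 0 < k) {α H A : ℝ}
    (hα : 0 < α) {Ω : Set (EuclideanSpace ℝ (Fin n))} (hΩ : IsOpen Ω)
    {f g : EuclideanSpace ℝ (Fin n) → ℝ} (hf : ContinuousOn f Ω)
    (hg : PureDerivBounds k α H A g Ω) (hfg : ∀ x ∈ Ω, |f x| ^ ((k : ℝ) + α) = |g x|) :
    HasWeakGradientOn f (rootGradient (k + α) f g) Ω := by
  have hs : 0 < (k : ℝ) + α := by positivity
  refine ⟨hf.locallyIntegrableOn hΩ.measurableSet, fun x hx => ?_, fun φ hφ hφc hφΩ i => ?_⟩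
  · obtain ⟨r, hr, hrΩ⟩ := Metric.nhds_basis_closedBall.mem_iff.1 (hΩ.mem_nhds hx)
    exact ⟨Metric.closedBall x r,
      mem_nhdsWithin_of_mem_nhds (Metric.closedBall_mem_nhds x hr),
      integrableOn_rootGradient hn hk hα hΩ (isCompact_closedBall x r) hrΩ hf hg hfg⟩
  set e : EuclideanSpace ℝ (Fin n) := EuclideanSpace.single i (1 : ℝ) with he
  set F := rootGradient (k + α) f g with hF
  set K := tsupport φ with hKdef
  have hK : IsCompact K := hφc
  have hKm : MeasurableSet K := hK.measurableSet
  have hfK : ContinuousOn f K := hf.mono hφΩ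
  have hφ0 : ∀ x, x ∉ K → φ x = 0 := fun x hx => image_eq_zero_of_notMem_tsupport hx
  have hφ'0 : ∀ x, x ∉ K → fderiv ℝ φ x e = 0 := fun x hx => by
    rw [fderiv_of_notMem_tsupport ℝ hx]; rfl
  have hφ'c : Continuous fun x => fderiv ℝ φ x e :=
    (hφ.continuous_fderiv (by simp)).clm_apply continuous_const
  have hFK : IntegrableOn (fun x => F x i) K :=
    (EuclideanSpace.proj (𝕜 := ℝ) i).integrable_comp
      (integrableOn_rootGradient hn hk hα hΩ hK hφΩ hf hg hfg)
  have hFφ : IntegrableOn (fun x => F x i * φ x) K :=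
    hFK.mul_continuousOn hφ.continuous.continuousOn hK
  have hfφ : IntegrableOn (fun x => f x * fderiv ℝ φ x e) K :=
    (hfK.mul hφ'c.continuousOn).integrableOn_compact hK
  have hder : ∀ ε : ℝ, 0 < ε → ∀ x ∈ Ω, HasFDerivAt (fun y => truncation ε (f y))
      (cutoff ε (f x) • (1 / ((k : ℝ) + α) * (f x / g x)) • fderiv ℝ g x) x := fun ε hε x hx =>
    hasFDerivAt_truncation_root hs hε (hf.continuousAt (hΩ.mem_nhds hx))
      ((hg.contDiffOn.contDiffAt (hΩ.mem_nhds hx)).differentiableAt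
        (by exact_mod_cast hk.ne'))
      (Filter.mem_of_superset (hΩ.mem_nhds hx) hfg)
  have hderi : ∀ ε : ℝ, 0 < ε → ∀ x ∈ K,
      fderiv ℝ (fun y => truncation ε (f y)) x e = cutoff ε (f x) * F x i := by
    intro ε hε x hx
    rw [(hder ε hε x (hφΩ hx)).fderiv, hF, rootGradient_apply]
    simp [he]
  have htrc : ∀ ε, ContinuousOn (fun x => truncation ε (f x)) K := fun ε x hx =>
    (hasDerivAt_truncation ε (f x)).continuousAt.comp_continuousWithinAt (hfK x hx)
  have hcutc : ∀ ε, ContinuousOn (fun x => cutoff ε (f x)) K := fun ε =>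
    (continuous_cutoff ε).comp_continuousOn hfK
  -- Integration by parts takes place on the whole space; every integrand contains `φ` or its
  -- derivative, so values of `f` outside `K` play no role.
  have hext : ∀ u : EuclideanSpace ℝ (Fin n) → ℝ, (∀ x, x ∉ K → u x = 0) →
      IntegrableOn u K → Integrable u := fun u hu hui =>
    (integrableOn_iff_integrable_of_support_subset fun x hx => by
      by_contra h; exact hx (hu x h)).1 hui
  have hparts : ∀ ε : ℝ, 0 < ε → ∫ x in K, truncation ε (f x) * fderiv ℝ φ x e =
      - ∫ x in K, cutoff ε (f x) * (F x i * φ x) := by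
    intro ε hε
    have h1 : IntegrableOn (fun x => cutoff ε (f x) * (F x i * φ x)) K :=
      hFφ.continuousOn_mul (hcutc ε) hK
    have h2 : EqOn (fun x => fderiv ℝ (fun y => truncation ε (f y)) x e * φ x)
        (fun x => cutoff ε (f x) * (F x i * φ x)) K := fun x hx => by
      simp only [hderi ε hε x hx]; ring
    have hint := integral_mul_fderiv_eq_neg_fderiv_mul_of_integrable (μ := volume)
      (f := fun y => truncation ε (f y)) (g := φ) (v := e)
      (hext _ (fun x hx => by simp [hφ0 x hx]) (h1.congr_fun h2.symm hKm))
      (hext _ (fun x hx => by simp [hφ'0 x hx])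
        (((htrc ε).mul hφ'c.continuousOn).integrableOn_compact hK))
      (hext _ (fun x hx => by simp [hφ0 x hx])
        (((htrc ε).mul hφ.continuous.continuousOn).integrableOn_compact hK))
      (fun x hx => (hder ε hε x (hφΩ hx)).differentiableAt)
      (fun x _ => (hφ.differentiable (by simp)).differentiableAt)
    rw [← setIntegral_congr_fun hKm h2,
      setIntegral_eq_integral_of_forall_compl_eq_zero fun x hx => by simp [hφ'0 x hx],
      setIntegral_eq_integral_of_forall_compl_eq_zero fun x hx => by simp [hφ0 x hx]]
    exact hint
  have hεpos : ∀ m : ℕ, (0 : ℝ) < 1 / ((m : ℝ) + 1) := fun m => Nat.one_div_pos_of_nat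
  have hlim1 : Tendsto (fun m : ℕ => ∫ x in K, truncation (1 / ((m : ℝ) + 1)) (f x) *
      fderiv ℝ φ x e) atTop (𝓝 (∫ x in K, f x * fderiv ℝ φ x e)) := by
    refine tendsto_integral_of_dominated_convergence (fun x => ‖f x * fderiv ℝ φ x e‖)
      (fun m => ((htrc _).mul hφ'c.continuousOn).aestronglyMeasurable hKm) hfφ.norm
      (fun m => Eventually.of_forall fun x => ?_)
      (Eventually.of_forall fun x => (tendsto_truncation (f x)).mul_const _)
    rw [norm_mul, norm_mul]
    gcongr
    exact abs_truncation_le _ _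
  have hlim2 : Tendsto (fun m : ℕ => ∫ x in K, cutoff (1 / ((m : ℝ) + 1)) (f x) *
      (F x i * φ x)) atTop (𝓝 (∫ x in K, F x i * φ x)) := by
    refine tendsto_integral_of_dominated_convergence (fun x => ‖F x i * φ x‖)
      (fun m => (hFφ.continuousOn_mul (hcutc _) hK).aestronglyMeasurable) hFφ.norm
      (fun m => Eventually.of_forall fun x => ?_)
      (Eventually.of_forall fun x => ?_)
    · rw [norm_mul]
      exact mul_le_of_le_one_left (norm_nonneg _) (abs_cutoff_le _ _)
    -- The cutoff does not tend to `1` at zeros of `f`, but there `F` vanishes.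
    · by_cases h0 : f x = 0
      · have : F x i = 0 := by rw [hF, rootGradient_apply, h0]; simp
        simp [this]
      · simpa using (tendsto_cutoff h0).mul_const (F x i * φ x)
  have hlim : ∫ x in K, f x * fderiv ℝ φ x e = - ∫ x in K, F x i * φ x :=
    tendsto_nhds_unique hlim1
      (hlim2.neg.congr fun m => (hparts _ (hεpos m)).symm)
  rw [setIntegral_eq_of_subset_of_forall_sdiff_eq_zero hΩ.measurableSet hφΩ
      (fun x hx => by simp [hφ'0 x hx.2]),
    setIntegral_eq_of_subset_of_forall_sdiff_eq_zero hΩ.measurableSet hφΩ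
      (fun x hx => by simp [hφ0 x hx.2])]
  exact hlim

/-! ### From the norms of the statement to real bounds -/

/-- A continuous function is bounded everywhere in an open set by its essential supremum. -/
lemma enorm_le_eLpNorm_top_of_continuousOn {E : Type*} [NormedAddCommGroup E]
    {Ω : Set (EuclideanSpace ℝ (Fin n))} (hΩ : IsOpen Ω) {u : EuclideanSpace ℝ (Fin n) → E}
    (hu : ContinuousOn u Ω) {x : EuclideanSpace ℝ (Fin n)} (hx : x ∈ Ω) :
    ‖u x‖ₑ ≤ eLpNorm u ⊤ (volume.restrict Ω) := by
  by_contra! h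
  have hopen : IsOpen (Ω ∩ (fun y => ‖u y‖ₑ) ⁻¹' Ioi (eLpNorm u ⊤ (volume.restrict Ω))) :=
    hu.enorm.isOpen_inter_preimage hΩ isOpen_Ioi
  have hpos := hopen.measure_pos volume ⟨x, hx, h⟩
  have hae := ae_le_eLpNormEssSup (f := u) (μ := volume.restrict Ω)
  rw [← eLpNorm_exponent_top, ae_restrict_iff' hΩ.measurableSet] at hae
  refine hpos.ne' (measure_mono_null ?_ hae)
  rintro y ⟨hy, hlt⟩ hle
  exact absurd (hle hy) (not_le.2 hlt)

lemma memHolder_partialDeriv {k : ℕ} {α : ℝ≥0} {g : EuclideanSpace ℝ (Fin n) → ℝ}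
    {Ω : Set (EuclideanSpace ℝ (Fin n))} (hg : MemCkHolder k α g Ω) (s : Fin k → Fin n) :
    MemHolder α (fun x : Ω => partialDeriv s g x) := by
  obtain ⟨C, hC⟩ := hg.holder s
  exact ⟨C, fun x y => hC x x.2 y y.2⟩

lemma holderConst_ne_top {k : ℕ} {α : ℝ≥0} {g : EuclideanSpace ℝ (Fin n) → ℝ}
    {Ω : Set (EuclideanSpace ℝ (Fin n))} (hg : MemCkHolder k α g Ω) :
    holderConst k α g Ω ≠ ⊤ := by
  have hsum : ∑ s : Fin k → Fin n, eHolderNorm α (fun x : Ω => partialDeriv s g x) < ⊤ :=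
    ENNReal.sum_lt_top.2 fun s _ => eHolderNorm_lt_top.2 (memHolder_partialDeriv hg s)
  refine ((iSup_le fun s => ?_).trans_lt hsum).ne
  exact Finset.single_le_sum_of_canonicallyOrdered
    (f := fun s : Fin k → Fin n => eHolderNorm α (fun x : Ω => partialDeriv s g x))
    (Finset.mem_univ s)

lemma abs_partialDeriv_sub_le {k : ℕ} {α : ℝ≥0} {g : EuclideanSpace ℝ (Fin n) → ℝ}
    {Ω : Set (EuclideanSpace ℝ (Fin n))} (hg : MemCkHolder k α g Ω) (s : Fin k → Fin n)
    {x y : EuclideanSpace ℝ (Fin n)} (hx : x ∈ Ω) (hy : y ∈ Ω) :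
    |partialDeriv s g x - partialDeriv s g y| ≤
      (holderConst k α g Ω).toReal * ‖x - y‖ ^ (α : ℝ) := by
  have hmem := memHolder_partialDeriv hg s
  have h1 := hmem.holderWith.dist_le (⟨x, hx⟩ : Ω) ⟨y, hy⟩
  rw [Subtype.dist_eq, dist_eq_norm, dist_eq_norm, Real.norm_eq_abs] at h1
  refine h1.trans ?_
  gcongr
  exact ENNReal.toReal_mono (holderConst_ne_top hg)
    (le_iSup (fun s : Fin k → Fin n => eHolderNorm α (fun x : Ω => partialDeriv s g x)) s)

lemma eLpNorm_gradient_ne_top {k : ℕ} (hk : 0 < k) {α : ℝ≥0} {g : EuclideanSpace ℝ (Fin n) → ℝ}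
    {Ω : Set (EuclideanSpace ℝ (Fin n))} (hΩ : IsOpen Ω) (hg : MemCkHolder k α g Ω) :
    eLpNorm (∇ g) ⊤ (volume.restrict Ω) ≠ ⊤ := by
  choose B hB using fun i : Fin n => hg.bounded 1 le_rfl hk (fun _ => i)
  rw [eLpNorm_exponent_top]
  refine (eLpNormEssSup_lt_top_of_ae_bound (C := ∑ i, B i) ?_).ne
  refine ae_restrict_of_forall_mem hΩ.measurableSet fun x hx => ?_
  refine (norm_le_sum_abs_apply _).trans (Finset.sum_le_sum fun i _ => ?_)
  rw [gradient_apply, ← partialDeriv_one (fun _ => i)]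
  exact hB i x hx

/-- Both norms are finite on the class, so they can be read as reals. The essential supremum bounds
the gradient at every point because the gradient is continuous on an open set. -/
lemma MemCkHolder.pureDerivBounds {k : ℕ} (hk : 0 < k) {α : ℝ≥0}
    {g : EuclideanSpace ℝ (Fin n) → ℝ} {Ω : Set (EuclideanSpace ℝ (Fin n))} (hΩ : IsOpen Ω)
    (hg : MemCkHolder k α g Ω) :
    PureDerivBounds k α (holderConst k α g Ω).toReal
      (eLpNorm (∇ g) ⊤ (volume.restrict Ω)).toReal g Ω where
  contDiffOn := hg.contDiffOn
  nonneg_holder := ENNReal.toReal_nonneg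
  nonneg_deriv := ENNReal.toReal_nonneg
  holder i x hx y hy := abs_partialDeriv_sub_le hg _ hx hy
  deriv i x hx := by
    have hg1 : ContDiffOn ℝ 1 g Ω := hg.contDiffOn.of_le (by exact_mod_cast hk)
    have h1 := ENNReal.toReal_mono (eLpNorm_gradient_ne_top hk hΩ hg)
      (enorm_le_eLpNorm_top_of_continuousOn hΩ (continuousOn_gradient hΩ hg1) hx)
    rw [toReal_enorm] at h1
    rw [← gradient_apply, ← Real.norm_eq_abs]
    exact (PiLp.norm_apply_le _ i).trans h1

end RootRegularity

/-! ### The main theorem -/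

theorem theorem2p4 (n k : ℕ) (hn : 0 < n) (hk : 0 < k)
    (Ω : Set (EuclideanSpace ℝ (Fin n))) (hΩ : IsOpen Ω) :
    ∃ C₁ C₂ : Set (EuclideanSpace ℝ (Fin n)) → ℝ≥0,
      ∀ (α : ℝ≥0), 0 < α → α ≤ 1 →
      ∀ p : ℝ, 1 / p + 1 / ((k : ℝ) + α) = 1 →
      ∀ f g : EuclideanSpace ℝ (Fin n) → ℝ,
        ContinuousOn f Ω → RootRegularity.MemCkHolder k α g Ω →
        (∀ x ∈ Ω, |f x| ^ ((k : ℝ) + α) = |g x|) →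
        ∃ F : EuclideanSpace ℝ (Fin n) → EuclideanSpace ℝ (Fin n),
          RootRegularity.HasWeakGradientOn f F Ω ∧
          ∀ Ω' : Set (EuclideanSpace ℝ (Fin n)),
            IsOpen Ω' → IsCompact (closure Ω') → closure Ω' ⊆ Ω →
            RootRegularity.MemWeakLp p F Ω' ∧
            RootRegularity.weakLpNorm p F Ω' ≤
              max (C₁ Ω' * RootRegularity.holderConst k α g Ω ^ (1 / ((k : ℝ) + α)))
                (C₂ Ω' * eLpNorm (∇ g) ⊤ (volume.restrict Ω) ^ (1 / ((k : ℝ) + α))) := by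
  have hC : ∀ Ω' : Set (EuclideanSpace ℝ (Fin n)), ∃ C : ℝ≥0, IsCompact (closure Ω') →
      closure Ω' ⊆ Ω → ∀ α H A p : ℝ, 0 < α → 1 / p + 1 / ((k : ℝ) + α) = 1 →
      ∀ f g : EuclideanSpace ℝ (Fin n) → ℝ, RootRegularity.PureDerivBounds k α H A g Ω →
      (∀ x ∈ Ω, |f x| ^ ((k : ℝ) + α) = |g x|) →
      RootRegularity.weakLpNorm p (RootRegularity.rootGradient (k + α) f g) (closure Ω') ≤
        C * ENNReal.ofReal (max (H ^ (1 / ((k : ℝ) + α))) (A ^ (1 / ((k : ℝ) + α)))) := by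
    intro Ω'
    -- The constant is a function of all sets; those not compactly contained in `Ω` get the dummy
    -- value `0`.
    by_cases h : IsCompact (closure Ω') ∧ closure Ω' ⊆ Ω
    · obtain ⟨C, hC⟩ := RootRegularity.exists_weakLpNorm_rootGradient_le hn hk hΩ h.1 h.2
      exact ⟨C, fun _ _ => hC⟩
    · exact ⟨0, fun h1 h2 => absurd ⟨h1, h2⟩ h⟩
  choose C hC using hC
  -- One constant serves for both terms, since it multiplies a maximum.
  refine ⟨C, C, fun α hα _ p hp f g hf hg hfg => ?_⟩
  have hα' : (0 : ℝ) < α := by exact_mod_cast hα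
  have hb := hg.pureDerivBounds hk hΩ
  have hs : 0 ≤ 1 / ((k : ℝ) + α) := by positivity
  have hk1 : (1 : ℝ) ≤ k := by exact_mod_cast hk
  have hp0 : 0 ≤ 1 / p := by
    have : 1 / ((k : ℝ) + α) ≤ 1 := by
      rw [div_le_one (by positivity)]; linarith
    linarith
  have hH := RootRegularity.holderConst_ne_top hg
  have hA := RootRegularity.eLpNorm_gradient_ne_top hk hΩ hg
  refine ⟨RootRegularity.rootGradient (k + α) f g,
    RootRegularity.hasWeakGradientOn_rootGradient hn hk hα' hΩ hf hb hfg,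
    fun Ω' _ hcpt hsub => ?_⟩
  have hle : RootRegularity.weakLpNorm p (RootRegularity.rootGradient (k + α) f g) Ω' ≤
      max (C Ω' * RootRegularity.holderConst k α g Ω ^ (1 / ((k : ℝ) + α)))
        (C Ω' * eLpNorm (∇ g) ⊤ (volume.restrict Ω) ^ (1 / ((k : ℝ) + α))) := by
    have h1 := hC Ω' hcpt hsub α _ _ p hα' hp f g hb hfg
    rw [ENNReal.ofReal_max, ← ENNReal.ofReal_rpow_of_nonneg ENNReal.toReal_nonneg hs,
      ← ENNReal.ofReal_rpow_of_nonneg ENNReal.toReal_nonneg hs, ENNReal.ofReal_toReal hH,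
      ENNReal.ofReal_toReal hA, mul_max] at h1
    -- The bound on the compact closure restricts to `Ω'` by monotonicity of measure.
    refine le_trans (iSup_mono fun M => ?_) h1
    gcongr
    exact subset_closure
  refine ⟨⟨?_, hle.trans_lt (max_lt ?_ ?_)⟩, hle⟩
  · exact (RootRegularity.aestronglyMeasurable_rootGradient hΩ hf
      (hg.contDiffOn.of_le (by exact_mod_cast hk))).mono_measure
      (Measure.restrict_mono (subset_closure.trans hsub) le_rfl)
  · exact ENNReal.mul_lt_top ENNReal.coe_lt_top (ENNReal.rpow_lt_top_of_nonneg hs hH)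
  · exact ENNReal.mul_lt_top ENNReal.coe_lt_top (ENNReal.rpow_lt_top_of_nonneg hs hA)
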